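/- Let $d\ge 1$ be an integer, $\tau>0$ and $\sigma>1$, and put $M_0=1$, $M_p=p^{\tau p^{\sigma}}$ for $p\ge 1$. Let $\mathcal E_{\{\tau,\sigma\}}(\mathbb R^d)$ (respectively $\mathcal E_{(\tau,\sigma)}(\mathbb R^d)$) be the set of all $\phi\in C^\infty(\mathbb R^d)$ such that for every compact $K\subset\mathbb R^d$ there are $h>0$ and $C>0$ (respectively, for every compact $K$ and every $h>0$ there is $C>0$) with $$|\partial^\alpha\phi(x)|\le C\,h^{|\alpha|^\sigma}M_{|\alpha|}\qquad\text{for all }x\in K,\ \alpha\in\mathbb N_0^d.$$ For $t>1$ let $\mathcal G_t(\mathbb R^d)$ be the Gevrey class of all $\phi\in C^\infty(\mathbb R^d)$ such that for every compact $K\subset\mathbb R^d$ there are $h,C>0$ with $|\partial^\alpha\phi(x)|\le C\,h^{|\alpha|}\,(|\alpha|!)^t$ for all $x\in K$, $\alpha\in\mathbb N_0^d$. Then for every $a>0$ there is a function $\phi_a\colon\mathbb R^d\to\mathbb R$ that belongs to both $\mathcal E_{(\tau,\sigma)}(\mathbb R^d)$ and $\mathcal E_{\{\tau,\sigma\}}(\mathbb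 R^d)$ and satisfies $$\phi_a\ge 0,\qquad \operatorname{supp}\phi_a\subset[-a,a]^d,\qquad \int_{\mathbb R^d}\phi_a(x)\,dx=1,\qquad \phi_a\notin\bigcup_{t>1}\mathcal G_t(\mathbb R^d).$$ Moreover, $\phi_a$ can be chosen of the form $\phi_a(x)=\prod_{i=1}^d\psi(x_i)$, where $\psi\in C^\infty(\mathbb R)$ is an infinite convolution of rescaled bump functions: there are a nonnegative even $f\in C^\infty(\mathbb R)$ with $\operatorname{supp} f\subset[-1,1]$ and $\int_{\mathbb R} f=1$, and numbers $r_p>0$ $(p\ge 0)$ with $\sum_p r_p\le a$, such that, with $f_r(x)=\frac1r f(\frac xr)$, the finite convolutions $f_{r_0}*f_{r_1}*\cdots*f_{r_p}$ converge to $\psi$ as $p\to\infty$, uniformly on $\mathbb R$ together with all derivatives. -/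

import Mathlib

open scoped ContDiff

namespace ExtGevrey

/-- The classical partial derivative `∂φ/∂xᵢ`, as a function on `ℝ^d`. The space `ℝ^d` is
`Fin d → ℝ`; only its topology, smooth structure and Lebesgue measure are used, none of which
depends on the choice of a norm. -/
noncomputable def partialDeriv {d : ℕ} {F : Type*} [NormedAddCommGroup F] [NormedSpace ℝ F]
    (i : Fin d) (φ : (Fin d → ℝ) → F) : (Fin d → ℝ) → F :=
  fun x => lineDeriv ℝ φ x (Pi.single i 1)

/-- The mixed partial derivative `∂^α φ = ∂₁^{α₁} ⋯ ∂_d^{α_d} φ` for a multi-index `α`. -/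
noncomputable def multiDeriv {d : ℕ} {F : Type*} [NormedAddCommGroup F] [NormedSpace ℝ F]
    (α : Fin d → ℕ) (φ : (Fin d → ℝ) → F) : (Fin d → ℝ) → F :=
  (List.finRange d).foldr (fun i g => (partialDeriv i)^[α i] g) φ

/-- The length `|α| = α₁ + ⋯ + α_d` of a multi-index. -/
def len {d : ℕ} (α : Fin d → ℕ) : ℕ := ∑ i, α i

/-- The defining sequence `M_p = p ^ (τ p ^ σ)`; for `p = 0` see `weight_zero`. -/
noncomputable def weight (τ σ : ℝ) (p : ℕ) : ℝ := (p : ℝ) ^ (τ * (p : ℝ) ^ σ)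

theorem weight_zero (τ σ : ℝ) (hσ : 1 < σ) : weight τ σ 0 = 1 := by
  have h : σ ≠ 0 := by linarith
  simp [weight, Real.zero_rpow h]

/-- Membership in the Gevrey class `𝒢_t(ℝ^d)`. -/
def IsGevrey {d : ℕ} {F : Type*} [NormedAddCommGroup F] [NormedSpace ℝ F]
    (t : ℝ) (φ : (Fin d → ℝ) → F) : Prop :=
  ContDiff ℝ ∞ φ ∧
    ∀ K : Set (Fin d → ℝ), IsCompact K → ∃ h : ℝ, 0 < h ∧ ∃ C : ℝ, 0 < C ∧
      ∀ x ∈ K, ∀ α : Fin d → ℕ,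
        ‖multiDeriv α φ x‖ ≤ C * h ^ len α * ((len α).factorial : ℝ) ^ t

/-- Membership in the extended Gevrey class of Roumieu type `ℰ_{{τ,σ}}(ℝ^d)`. -/
def IsRoumieu {d : ℕ} {F : Type*} [NormedAddCommGroup F] [NormedSpace ℝ F]
    (τ σ : ℝ) (φ : (Fin d → ℝ) → F) : Prop :=
  ContDiff ℝ ∞ φ ∧
    ∀ K : Set (Fin d → ℝ), IsCompact K → ∃ h : ℝ, 0 < h ∧ ∃ C : ℝ, 0 < C ∧
      ∀ x ∈ K, ∀ α : Fin d → ℕ,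
        ‖multiDeriv α φ x‖ ≤ C * h ^ ((len α : ℝ) ^ σ) * weight τ σ (len α)

/-- Membership in the extended Gevrey class of Beurling type `ℰ_{(τ,σ)}(ℝ^d)`. -/
def IsBeurling {d : ℕ} {F : Type*} [NormedAddCommGroup F] [NormedSpace ℝ F]
    (τ σ : ℝ) (φ : (Fin d → ℝ) → F) : Prop :=
  ContDiff ℝ ∞ φ ∧
    ∀ K : Set (Fin d → ℝ), IsCompact K → ∀ h : ℝ, 0 < h → ∃ C : ℝ, 0 < C ∧
      ∀ x ∈ K, ∀ α : Fin d → ℕ,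
        ‖multiDeriv α φ x‖ ≤ C * h ^ ((len α : ℝ) ^ σ) * weight τ σ (len α)

/-- A bump function on the line: smooth, nonnegative, even, supported in `[-1,1]`,
with integral `1`. -/
structure IsBump (f : ℝ → ℝ) : Prop where
  smooth : ContDiff ℝ ∞ f
  nonneg : ∀ x, 0 ≤ f x
  even : ∀ x, f (-x) = f x
  supp : tsupport f ⊆ Set.Icc (-1) 1
  integral_eq : ∫ x, f x = 1

/-- The rescaling `f_r(x) = (1/r) f(x/r)`. -/
noncomputable def rescale (f : ℝ → ℝ) (r : ℝ) : ℝ → ℝ := fun x => 1 / r * f (x / r)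

/-- The finite convolution `f_{r₀} * f_{r₁} * ⋯ * f_{r_p}`. -/
noncomputable def partialConv (f : ℝ → ℝ) (r : ℕ → ℝ) : ℕ → ℝ → ℝ
  | 0 => rescale f (r 0)
  | p + 1 => MeasureTheory.convolution (partialConv f r p) (rescale f (r (p + 1)))
      (ContinuousLinearMap.mul ℝ ℝ) MeasureTheory.volume

/-- `ψ` is the infinite convolution `f_{r₀} * f_{r₁} * ⋯`: it is smooth, and the finite
convolutions converge to it, uniformly on the line together with all derivatives. -/
def IsInfiniteConv (f : ℝ → ℝ) (r : ℕ → ℝ) (ψ : ℝ → ℝ) : Prop :=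
  ContDiff ℝ ∞ ψ ∧
    ∀ n : ℕ, TendstoUniformly (fun p => iteratedDeriv n (partialConv f r p))
      (iteratedDeriv n ψ) Filter.atTop

end ExtGevrey

namespace ExtGevrey

open MeasureTheory Filter Topology
open scoped Convolution FourierTransform

/-! The radii are `r p = ρ * 3 ^ (-e_p)`, where `e_p` is about `(p + 1) ^ (σ - 1)`. To differentiate
the infinite convolution `n` times, one derivative is spent on each of the factors `1, …, n`; the
cost is a product of `‖f'‖₁ / r k`, hence at most `exp (B * n ^ σ)` (`exists_prod_le_exp_rpow`). The
weight is `exp (τ * n ^ σ * log n)`, and its logarithm absorbs both `B` and any `h ^ (n ^ σ)`, which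
gives the Beurling bounds.

Failure of Gevrey regularity is read off the Fourier side, where the transform of `ψ` is the product
of the values `f̂ (r p * ξ)`. At `ξ = 3 ^ m / ρ` all these arguments are integer powers of `3`. So
it suffices to have a bump whose transform is not too small on positive powers of `3` and close to
`1` near the origin: a positive definite cutoff times a lacunary cosine series
(`exists_isBump_fourier_lower_bound`). The product is then at least `exp (-C * (m + 1) ^ k)`, an
exponential of a power of `log ξ`, whereas Gevrey regularity and compact support force decay faster
than that (`not_gevrey_of_fourier_lower_bound`). Tensor products carry everything to dimension `d`.
-/

/-! ### Derivatives and sup bounds of convolutions on the line. -/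

theorem contDiff_iteratedDeriv {g : ℝ → ℝ} (hg : ContDiff ℝ ∞ g) (n : ℕ) :
    ContDiff ℝ ∞ (iteratedDeriv n g) := by
  rw [contDiff_infty] at hg ⊢
  intro k
  exact (hg (k + n)).iterate_deriv' k n |> fun h => by rwa [← iteratedDeriv_eq_iterate] at h

theorem hasCompactSupport_iteratedDeriv {g : ℝ → ℝ} (hg : HasCompactSupport g) (n : ℕ) :
    HasCompactSupport (iteratedDeriv n g) := by
  induction n with
  | zero => simpa using hg
  | succ n ih => rw [iteratedDeriv_succ]; exact ih.deriv

theorem iteratedDeriv_convolution {g h : ℝ → ℝ} (hg : ContDiff ℝ ∞ g)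
    (hgc : HasCompactSupport g) (hh : LocallyIntegrable h) (n : ℕ) :
    iteratedDeriv n (g ⋆[ContinuousLinearMap.mul ℝ ℝ] h) =
      (iteratedDeriv n g) ⋆[ContinuousLinearMap.mul ℝ ℝ] h := by
  induction n with
  | zero => simp
  | succ n ih =>
    rw [iteratedDeriv_succ, ih]
    ext x
    rw [((hasCompactSupport_iteratedDeriv hgc n).hasDerivAt_convolution_left _
      ((contDiff_iteratedDeriv hg n).of_le (by simp)) hh x).deriv, iteratedDeriv_succ]

/-- Only the last derivative moves to the second factor. Iterated along the convolution, this lets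
each new factor spend exactly one derivative. -/
theorem iteratedDeriv_succ_convolution {g h : ℝ → ℝ} (hg : ContDiff ℝ ∞ g)
    (hgc : HasCompactSupport g) (hh : ContDiff ℝ ∞ h) (hhc : HasCompactSupport h) (n : ℕ) :
    iteratedDeriv (n + 1) (g ⋆[ContinuousLinearMap.mul ℝ ℝ] h) =
      (iteratedDeriv n g) ⋆[ContinuousLinearMap.mul ℝ ℝ] (deriv h) := by
  rw [iteratedDeriv_succ,
    iteratedDeriv_convolution hg hgc hh.continuous.locallyIntegrable]
  ext x
  exact (hhc.hasDerivAt_convolution_right _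
    (contDiff_iteratedDeriv hg n).continuous.locallyIntegrable (hh.of_le (by simp)) x).deriv

theorem abs_convolution_le {g h : ℝ → ℝ} {G : ℝ} (hG : ∀ x, |g x| ≤ G)
    (hh : Integrable h) (x : ℝ) :
    |(g ⋆[ContinuousLinearMap.mul ℝ ℝ] h) x| ≤ G * ∫ y, |h y| := by
  have h1 : ∫ y, |h (x - y)| = ∫ y, |h y| := integral_sub_left_eq_self (fun y => |h y|) volume x
  rw [← h1, ← integral_const_mul, convolution_def, ← Real.norm_eq_abs]
  refine (norm_integral_le_integral_norm _).trans ?_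
  refine integral_mono_of_nonneg (ae_of_all _ fun y => norm_nonneg _)
    ((hh.comp_sub_left x).abs.const_mul G) (ae_of_all _ fun y => ?_)
  simp only [ContinuousLinearMap.mul_apply', norm_mul, Real.norm_eq_abs]
  exact mul_le_mul_of_nonneg_right (hG y) (abs_nonneg _)

/-- Convolving with a probability density on `[-r, r]` averages `g` over points within distance `r`,
so the mean value inequality applies. -/
theorem abs_convolution_sub_le {g h : ℝ → ℝ} {G r : ℝ} (hg : ContDiff ℝ ∞ g)
    (hG : ∀ x, |deriv g x| ≤ G) (hh : Continuous h) (hhc : HasCompactSupport h)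
    (h0 : ∀ x, 0 ≤ h x)
    (h1 : ∫ x, h x = 1) (hr : ∀ x, h x ≠ 0 → |x| ≤ r) (x : ℝ) :
    |(g ⋆[ContinuousLinearMap.mul ℝ ℝ] h) x - g x| ≤ r * G := by
  have hi : Integrable (fun y => h (x - y)) :=
    (hh.integrable_of_hasCompactSupport hhc).comp_sub_left x
  have e1 : ∫ y, h (x - y) = 1 := (integral_sub_left_eq_self h volume x).trans h1
  have hgd : Differentiable ℝ g := hg.differentiable (by simp)
  have i1 : Integrable (fun y => g y * h (x - y)) :=
    Continuous.integrable_of_hasCompactSupport (by have := hg.continuous; fun_prop)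
      ((hhc.comp_homeomorph (Homeomorph.subLeft x)).mul_left)
  have e2 : (g ⋆[ContinuousLinearMap.mul ℝ ℝ] h) x - g x =
      ∫ y, (g y - g x) * h (x - y) := by
    rw [convolution_def]
    simp only [ContinuousLinearMap.mul_apply', sub_mul]
    rw [integral_sub i1 (hi.const_mul _), integral_const_mul, e1, mul_one]
  rw [e2]
  have e3 : r * G = ∫ y, (r * G) * h (x - y) := by rw [integral_const_mul, e1, mul_one]
  rw [e3, ← Real.norm_eq_abs]
  refine (norm_integral_le_integral_norm _).trans ?_
  refine integral_mono_of_nonneg (ae_of_all _ fun y => norm_nonneg _)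
    (hi.const_mul _) (ae_of_all _ fun y => ?_)
  simp only [norm_mul, Real.norm_eq_abs, abs_of_nonneg (h0 _)]
  by_cases hy : h (x - y) = 0
  · simp [hy]
  refine mul_le_mul_of_nonneg_right ?_ (h0 _)
  have h2 := Convex.norm_image_sub_le_of_norm_deriv_le (f := g) (s := Set.univ) (x := x) (y := y)
    (C := G) (fun z _ => hgd z) (fun z _ => hG z) convex_univ trivial trivial
  have h3 := hr _ hy
  have hG0 : 0 ≤ G := (abs_nonneg _).trans (hG 0)
  rw [Real.norm_eq_abs, Real.norm_eq_abs, abs_sub_comm y x] at h2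
  nlinarith

/-! ### Rescaled bumps. -/

section Rescale

variable {f : ℝ → ℝ} {r : ℝ}

theorem IsBump.abs_le_one (hf : IsBump f) {x : ℝ} (hx : f x ≠ 0) : |x| ≤ 1 :=
  abs_le.2 (hf.supp (subset_tsupport _ hx))

theorem IsBump.hasCompactSupport (hf : IsBump f) : HasCompactSupport f :=
  isCompact_Icc.of_isClosed_subset (isClosed_tsupport _) hf.supp

theorem IsBump.contDiff_rescale (hf : IsBump f) : ContDiff ℝ ∞ (rescale f r) := by
  unfold rescale
  exact contDiff_const.mul (hf.smooth.comp (contDiff_id.div_const r))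

theorem IsBump.rescale_nonneg (hf : IsBump f) (hr : 0 < r) (x : ℝ) : 0 ≤ rescale f r x :=
  mul_nonneg (by positivity) (hf.nonneg _)

theorem IsBump.abs_le_of_rescale_ne_zero (hf : IsBump f) (hr : 0 < r) {x : ℝ}
    (hx : rescale f r x ≠ 0) : |x| ≤ r := by
  have h := hf.abs_le_one (right_ne_zero_of_mul hx)
  rwa [abs_div, abs_of_pos hr, div_le_one hr] at h

theorem hasCompactSupport_of_abs_le {g : ℝ → ℝ} {R : ℝ} (h : ∀ x, g x ≠ 0 → |x| ≤ R) :
    HasCompactSupport g :=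
  HasCompactSupport.of_support_subset_isCompact (isCompact_Icc (a := -R) (b := R))
    fun x hx => abs_le.1 (h x hx)

theorem IsBump.hasCompactSupport_rescale (hf : IsBump f) (hr : 0 < r) :
    HasCompactSupport (rescale f r) :=
  hasCompactSupport_of_abs_le fun _ => hf.abs_le_of_rescale_ne_zero hr

theorem IsBump.integral_rescale (hf : IsBump f) (hr : 0 < r) : ∫ x, rescale f r x = 1 := by
  unfold rescale
  rw [integral_const_mul, Measure.integral_comp_div f r, hf.integral_eq, abs_of_pos hr]
  simp [hr.ne']

theorem IsBump.deriv_rescale (hf : IsBump f) (x : ℝ) :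
    deriv (rescale f r) x = 1 / r * (1 / r * deriv f (x / r)) := by
  have h1 : HasDerivAt f (deriv f (x / r)) (x / r) :=
    ((hf.smooth.differentiable (by simp)) _).hasDerivAt
  have h2 := (h1.comp x ((hasDerivAt_id x).div_const r)).const_mul (1 / r)
  have h3 := h2.deriv
  simp only [Function.comp_def, id] at h3
  unfold rescale
  rw [h3]; ring

theorem IsBump.integral_abs_deriv_rescale (hf : IsBump f) (hr : 0 < r) :
    ∫ x, |deriv (rescale f r) x| = (∫ x, |deriv f x|) / r := by
  simp only [hf.deriv_rescale, abs_mul, integral_const_mul]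
  rw [Measure.integral_comp_div (fun x => |deriv f x|) r]
  have : 0 < 1 / r := by positivity
  simp only [abs_of_pos hr, abs_of_pos this, smul_eq_mul]
  field_simp

end Rescale

/-! ### Finite convolutions and existence of their limit. -/

section PartialConv

variable {f : ℝ → ℝ} {r : ℕ → ℝ}

theorem partialConv_smooth (hf : IsBump f) (hr : ∀ p, 0 < r p) (p : ℕ) :
    ContDiff ℝ ∞ (partialConv f r p) ∧ (∀ x, 0 ≤ partialConv f r p x) ∧
    ∀ x, partialConv f r p x ≠ 0 → |x| ≤ ∑ k ∈ Finset.range (p + 1), r k := by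
  induction p with
  | zero =>
    refine ⟨hf.contDiff_rescale, hf.rescale_nonneg (hr 0), fun x hx => ?_⟩
    simpa using hf.abs_le_of_rescale_ne_zero (hr 0) hx
  | succ p ih =>
    obtain ⟨h1, h2, h3⟩ := ih
    refine ⟨?_, fun x => ?_, fun x hx => ?_⟩
    · exact (hasCompactSupport_of_abs_le h3).contDiff_convolution_left (n := ⊤) _ h1
        hf.contDiff_rescale.continuous.locallyIntegrable
    · exact integral_nonneg fun y => mul_nonneg (h2 y) (hf.rescale_nonneg (hr _) _)
    · rw [Finset.sum_range_succ]
      by_contra hlt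
      apply hx
      change ∫ y, _ = (0 : ℝ)
      refine integral_eq_zero_of_ae (ae_of_all _ fun y => ?_)
      simp only [ContinuousLinearMap.mul_apply', Pi.zero_apply]
      by_contra hne
      have a1 := h3 y (left_ne_zero_of_mul hne)
      have a2 := hf.abs_le_of_rescale_ne_zero (hr _) (right_ne_zero_of_mul hne)
      apply hlt
      calc |x| = |y + (x - y)| := by ring_nf
        _ ≤ |y| + |x - y| := abs_add_le _ _
        _ ≤ _ := add_le_add a1 a2

theorem contDiff_partialConv (hf : IsBump f) (hr : ∀ p, 0 < r p) (p : ℕ) :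
    ContDiff ℝ ∞ (partialConv f r p) := (partialConv_smooth hf hr p).1

theorem hasCompactSupport_partialConv (hf : IsBump f) (hr : ∀ p, 0 < r p) (p : ℕ) :
    HasCompactSupport (partialConv f r p) :=
  hasCompactSupport_of_abs_le (partialConv_smooth hf hr p).2.2

/-- Convolution with a probability density does not increase the sup norm of any derivative; bounds
found at one stage persist at all later ones. -/
theorem abs_iteratedDeriv_partialConv_succ_le (hf : IsBump f) (hr : ∀ p, 0 < r p) {p n : ℕ}
    {G : ℝ} (hG : ∀ x, |iteratedDeriv n (partialConv f r p) x| ≤ G) (x : ℝ) :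
    |iteratedDeriv n (partialConv f r (p + 1)) x| ≤ G := by
  have e : partialConv f r (p + 1) = (partialConv f r p) ⋆[ContinuousLinearMap.mul ℝ ℝ]
      (rescale f (r (p + 1))) := rfl
  have hc := hf.contDiff_rescale (r := r (p + 1)) |>.continuous
  rw [e, iteratedDeriv_convolution (contDiff_partialConv hf hr p)
    (hasCompactSupport_partialConv hf hr p) hc.locallyIntegrable]
  have h := abs_convolution_le hG
    (hc.integrable_of_hasCompactSupport (hf.hasCompactSupport_rescale (hr _))) x
  simpa [abs_of_nonneg (hf.rescale_nonneg (hr (p + 1)) _), hf.integral_rescale (hr (p + 1))] using h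

theorem abs_iteratedDeriv_partialConv_le_of_le (hf : IsBump f) (hr : ∀ p, 0 < r p) {p q n : ℕ}
    (hpq : p ≤ q) {G : ℝ} (hG : ∀ x, |iteratedDeriv n (partialConv f r p) x| ≤ G) (x : ℝ) :
    |iteratedDeriv n (partialConv f r q) x| ≤ G := by
  induction q, hpq using Nat.le_induction generalizing x with
  | base => exact hG x
  | succ q _ ih => exact abs_iteratedDeriv_partialConv_succ_le hf hr ih x

/-- Factor `0` contributes its sup norm, and each later factor takes one derivative and contributes
the `L¹` norm of it. -/
theorem abs_iteratedDeriv_partialConv_self_le (hf : IsBump f) (hr : ∀ p, 0 < r p) {S : ℝ}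
    (hS : ∀ x, |f x| ≤ S) (n : ℕ) (x : ℝ) :
    |iteratedDeriv n (partialConv f r n) x| ≤
      S / r 0 * ∏ k ∈ Finset.range n, (∫ y, |deriv f y|) / r (k + 1) := by
  induction n generalizing x with
  | zero =>
    have := hr 0
    simp only [iteratedDeriv_zero, partialConv, rescale, abs_mul, Finset.range_zero,
      Finset.prod_empty, mul_one, abs_of_pos (one_div_pos.2 this)]
    rw [div_mul_eq_mul_div, one_mul]
    gcongr
    exact hS _
  | succ n ih =>
    have e : partialConv f r (n + 1) = (partialConv f r n) ⋆[ContinuousLinearMap.mul ℝ ℝ]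
      (rescale f (r (n + 1))) := rfl
    have hd : HasCompactSupport (deriv (rescale f (r (n + 1)))) :=
      (hf.hasCompactSupport_rescale (hr _)).deriv
    rw [e, iteratedDeriv_succ_convolution (contDiff_partialConv hf hr n)
      (hasCompactSupport_partialConv hf hr n) hf.contDiff_rescale
      (hf.hasCompactSupport_rescale (hr _)), Finset.prod_range_succ, ← mul_assoc,
      ← hf.integral_abs_deriv_rescale (hr (n + 1))]
    exact abs_convolution_le ih ((hf.contDiff_rescale.continuous_deriv
      (by simp)).integrable_of_hasCompactSupport hd) x

theorem abs_iteratedDeriv_partialConv_sub_le (hf : IsBump f) (hr : ∀ p, 0 < r p) {n : ℕ}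
    {G : ℝ} (hG : ∀ x, |iteratedDeriv (n + 1) (partialConv f r 0) x| ≤ G) (p : ℕ) (x : ℝ) :
    |iteratedDeriv n (partialConv f r (p + 1)) x - iteratedDeriv n (partialConv f r p) x| ≤
      r (p + 1) * G := by
  have e : partialConv f r (p + 1) = (partialConv f r p) ⋆[ContinuousLinearMap.mul ℝ ℝ]
      (rescale f (r (p + 1))) := rfl
  have hc := hf.contDiff_rescale (r := r (p + 1)) |>.continuous
  rw [e, iteratedDeriv_convolution (contDiff_partialConv hf hr p)
    (hasCompactSupport_partialConv hf hr p) hc.locallyIntegrable]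
  refine abs_convolution_sub_le (contDiff_iteratedDeriv (contDiff_partialConv hf hr p) n)
    (fun y => ?_) hc (hf.hasCompactSupport_rescale (hr _)) (hf.rescale_nonneg (hr _))
    (hf.integral_rescale (hr _)) (fun y => hf.abs_le_of_rescale_ne_zero (hr _)) x
  rw [← iteratedDeriv_succ]
  exact abs_iteratedDeriv_partialConv_le_of_le hf hr (Nat.zero_le p) hG y

theorem exists_abs_le_of_hasCompactSupport {g : ℝ → ℝ} (hg : Continuous g)
    (hgc : HasCompactSupport g) : ∃ G, ∀ x, |g x| ≤ G :=
  hgc.exists_bound_of_continuous hg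

/-- For a summable sequence of radii the infinite convolution exists. -/
theorem exists_isInfiniteConv (hf : IsBump f) (hr : ∀ p, 0 < r p) (hs : Summable r) :
    ∃ ψ, IsInfiniteConv f r ψ := by
  set g := partialConv f r with hgdef
  have hg : ∀ p, ContDiff ℝ ∞ (g p) := contDiff_partialConv hf hr
  have hG : ∀ n, ∃ G, ∀ x, |iteratedDeriv (n + 1) (g 0) x| ≤ G := fun n =>
    exists_abs_le_of_hasCompactSupport (contDiff_iteratedDeriv (hg 0) _).continuous
      (hasCompactSupport_iteratedDeriv (hasCompactSupport_partialConv hf hr 0) _)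
  choose G hG using hG
  -- The limit is a telescoping series. For fixed `n`, the `n`-th derivatives of its terms are
  -- bounded by `r (p + 1)` times a constant from stage `0`, so it may be differentiated termwise.
  let u : ℕ → ℝ → ℝ := fun p => g (p + 1) - g p
  have hu : ∀ p, ContDiff ℝ ∞ (u p) := fun p => (hg _).sub (hg _)
  let v : ℕ → ℕ → ℝ := fun n p => r (p + 1) * G n
  have hv : ∀ n, Summable (v n) := fun n => ((summable_nat_add_iff 1).2 hs).mul_right _
  have hd : ∀ n p x, iteratedDeriv n (u p) x =
      iteratedDeriv n (g (p + 1)) x - iteratedDeriv n (g p) x := fun n p x =>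
    iteratedDeriv_sub (((hg (p + 1)).of_le (by exact_mod_cast le_top)).contDiffAt)
      (((hg p).of_le (by exact_mod_cast le_top)).contDiffAt)
  have hb : ∀ n p x, ‖iteratedDeriv n (u p) x‖ ≤ v n p := fun n p x => by
    rw [hd, Real.norm_eq_abs]
    exact abs_iteratedDeriv_partialConv_sub_le hf hr (hG n) p x
  have hb' : ∀ (n p : ℕ) (x : ℝ), (n : ℕ∞) ≤ ⊤ → ‖iteratedFDeriv ℝ n (u p) x‖ ≤ v n p :=
    fun n p x _ => by rw [norm_iteratedFDeriv_eq_norm_iteratedDeriv]; exact hb n p x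
  have hw : ContDiff ℝ ∞ (fun x => ∑' p, u p x) :=
    contDiff_tsum (N := ⊤) hu (fun n _ => hv n) hb'
  refine ⟨fun x => g 0 x + ∑' p, u p x, (hg 0).add hw, fun n => ?_⟩
  have e1 : ∀ x, iteratedDeriv n (fun x => ∑' p, u p x) x = ∑' p, iteratedDeriv n (u p) x := by
    intro x
    rw [iteratedDeriv_eq_iteratedFDeriv, iteratedFDeriv_tsum_apply (N := ⊤) hu (fun n _ => hv n)
      hb' (by exact le_top)]
    simp only [iteratedDeriv_eq_iteratedFDeriv]
    have hsum : Summable fun p => iteratedFDeriv ℝ n (u p) x :=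
      Summable.of_norm_bounded (hv n) fun p => hb' n p x le_top
    exact (ContinuousMultilinearMap.apply ℝ (fun _ : Fin n => ℝ) ℝ (fun _ => 1)).map_tsum hsum
  have e2 : ∀ x, iteratedDeriv n (fun x => g 0 x + ∑' p, u p x) x =
      iteratedDeriv n (g 0) x + ∑' p, iteratedDeriv n (u p) x := by
    intro x
    rw [← e1]
    exact iteratedDeriv_add (((hg 0).of_le (by exact_mod_cast le_top)).contDiffAt)
      ((hw.of_le (by exact_mod_cast le_top)).contDiffAt)
  have h1 := tendstoUniformly_tsum_nat (hv n) (hb n)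
  rw [Metric.tendstoUniformly_iff] at h1 ⊢
  intro ε hε
  filter_upwards [h1 ε hε] with p hp x
  have e3 : iteratedDeriv n (g p) x = iteratedDeriv n (g 0) x +
      ∑ k ∈ Finset.range p, iteratedDeriv n (u k) x := by
    simp only [hd]
    rw [Finset.sum_range_sub (fun k => iteratedDeriv n (g k) x)]
    ring
  rw [e2, e3, dist_add_left]
  exact hp x

end PartialConv

/-! ### Sign, support and derivative bounds of the limit. -/

section InfiniteConv

variable {f : ℝ → ℝ} {r : ℕ → ℝ} {ψ : ℝ → ℝ}

theorem IsInfiniteConv.tendsto_iteratedDeriv (h : IsInfiniteConv f r ψ) (n : ℕ) (x : ℝ) :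
    Tendsto (fun p => iteratedDeriv n (partialConv f r p) x) atTop (𝓝 (iteratedDeriv n ψ x)) :=
  (h.2 n).tendsto_at x

theorem IsInfiniteConv.tendsto (h : IsInfiniteConv f r ψ) (x : ℝ) :
    Tendsto (fun p => partialConv f r p x) atTop (𝓝 (ψ x)) := by
  simpa using h.tendsto_iteratedDeriv 0 x

theorem IsInfiniteConv.nonneg (h : IsInfiniteConv f r ψ) (hf : IsBump f) (hr : ∀ p, 0 < r p)
    (x : ℝ) : 0 ≤ ψ x :=
  ge_of_tendsto' (h.tendsto x) fun p => (partialConv_smooth hf hr p).2.1 x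

theorem abs_le_of_partialConv_ne_zero (hf : IsBump f) (hr : ∀ p, 0 < r p) (hs : Summable r)
    {a : ℝ} (ha : ∑' p, r p ≤ a) {p : ℕ} {x : ℝ} (hx : partialConv f r p x ≠ 0) : |x| ≤ a :=
  ((partialConv_smooth hf hr p).2.2 x hx).trans
    ((hs.sum_le_tsum _ fun k _ => (hr k).le).trans ha)

theorem IsInfiniteConv.abs_le_of_ne_zero (h : IsInfiniteConv f r ψ) (hf : IsBump f)
    (hr : ∀ p, 0 < r p) (hs : Summable r) {a : ℝ} (ha : ∑' p, r p ≤ a) {x : ℝ}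
    (hx : ψ x ≠ 0) : |x| ≤ a := by
  by_contra hlt
  apply hx
  refine tendsto_nhds_unique (h.tendsto x) (tendsto_const_nhds.congr fun _ => ?_)
  by_contra hne
  exact hlt (abs_le_of_partialConv_ne_zero hf hr hs ha (Ne.symm hne))

theorem IsInfiniteConv.abs_iteratedDeriv_le (h : IsInfiniteConv f r ψ) (hf : IsBump f)
    (hr : ∀ p, 0 < r p) {S : ℝ} (hS : ∀ x, |f x| ≤ S) (n : ℕ) (x : ℝ) :
    |iteratedDeriv n ψ x| ≤
      S / r 0 * ∏ k ∈ Finset.range n, (∫ y, |deriv f y|) / r (k + 1) :=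
  le_of_tendsto (h.tendsto_iteratedDeriv n x).abs <| (eventually_ge_atTop n).mono fun _ hp =>
    abs_iteratedDeriv_partialConv_le_of_le hf hr hp
      (abs_iteratedDeriv_partialConv_self_le hf hr hS n) x

end InfiniteConv

/-! ### Fourier transforms of real functions. -/

/-- The Fourier transform of a real-valued function on the line. -/
noncomputable def realFourier (g : ℝ → ℝ) : ℝ → ℂ := 𝓕 (fun x => (g x : ℂ))

theorem realFourier_eq (g : ℝ → ℝ) (ξ : ℝ) :
    realFourier g ξ = ∫ x, Complex.exp ((-2 * Real.pi * x * ξ : ℝ) * Complex.I) * (g x : ℂ) := by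
  rw [realFourier, Real.fourier_real_eq_integral_exp_smul]
  rfl

theorem integrable_realFourier {g : ℝ → ℝ} (hg : Integrable g) (ξ : ℝ) :
    Integrable fun x : ℝ =>
      Complex.exp ((-2 * Real.pi * x * ξ : ℝ) * Complex.I) * (g x : ℂ) := by
  refine hg.ofReal.bdd_mul (c := 1) (by fun_prop) (ae_of_all _ fun x => ?_)
  rw [Complex.norm_exp_ofReal_mul_I]

theorem realFourier_re {g : ℝ → ℝ} (hg : Integrable g) (ξ : ℝ) :
    (realFourier g ξ).re = ∫ x, g x * Real.cos (2 * Real.pi * ξ * x) := by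
  rw [realFourier_eq, ← Complex.reCLM_apply,
    ← Complex.reCLM.integral_comp_comm (integrable_realFourier hg ξ)]
  congr 1
  ext x
  rw [Complex.reCLM_apply, Complex.re_mul_ofReal, Complex.exp_ofReal_mul_I_re, mul_comm,
    ← Real.cos_neg]
  ring_nf

theorem realFourier_im_of_even {g : ℝ → ℝ} (hg : Integrable g) (he : ∀ x, g (-x) = g x) (ξ : ℝ) :
    (realFourier g ξ).im = 0 := by
  have h : (realFourier g ξ).im = ∫ x, Real.sin (-2 * Real.pi * x * ξ) * g x := by
    rw [realFourier_eq, ← Complex.imCLM_apply,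
      ← Complex.imCLM.integral_comp_comm (integrable_realFourier hg ξ)]
    congr 1
    ext x
    rw [Complex.imCLM_apply, Complex.im_mul_ofReal, Complex.exp_ofReal_mul_I_im]
  have h2 := integral_neg_eq_self (fun x => Real.sin (-2 * Real.pi * x * ξ) * g x) volume
  have h3 : (fun x => Real.sin (-2 * Real.pi * -x * ξ) * g (-x)) =
      fun x => -(Real.sin (-2 * Real.pi * x * ξ) * g x) := by
    ext x
    rw [he, ← neg_mul, ← Real.sin_neg]
    ring_nf
  simp only [h3, integral_neg] at h2
  rw [h]
  linarith

theorem realFourier_convolution {g h : ℝ → ℝ} (hg : Integrable g) (hh : Integrable h) (ξ : ℝ) :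
    realFourier (g ⋆[ContinuousLinearMap.mul ℝ ℝ] h) ξ = realFourier g ξ * realFourier h ξ := by
  rw [realFourier, realFourier, realFourier,
    ← Real.fourier_mul_convolution_eq (R := ℂ) (f₁ := fun x => (g x : ℂ))
      (f₂ := fun x => (h x : ℂ)) hg.ofReal hh.ofReal]
  refine congrArg (fun u : ℝ → ℂ => 𝓕 u ξ) (funext fun x => ?_)
  rw [convolution_def, convolution_def, ← integral_complex_ofReal]
  simp

theorem realFourier_zero (g : ℝ → ℝ) : realFourier g 0 = ((∫ x, g x : ℝ) : ℂ) := by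
  rw [realFourier_eq, ← integral_complex_ofReal]
  simp

/-! ### A bump function with slowly decaying Fourier transform. -/

/-- There is a smooth even kernel with small support and nonnegative Fourier transform. -/
theorem exists_positive_definite_kernel : ∃ χ : ℝ → ℝ, ContDiff ℝ ∞ χ ∧ (∀ x, 0 ≤ χ x) ∧
    (∀ x, χ (-x) = χ x) ∧ (∀ x, χ x ≠ 0 → |x| ≤ 1 / 8) ∧
    (∀ ξ, 0 ≤ ∫ x, χ x * Real.cos (2 * Real.pi * ξ * x)) ∧ 0 < ∫ x, χ x := by
  let G : ContDiffBump (0 : ℝ) := ⟨1 / 32, 1 / 16, by norm_num, by norm_num⟩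
  have hGc : HasCompactSupport G := G.hasCompactSupport
  have hGi : Integrable G := G.continuous.integrable_of_hasCompactSupport hGc
  have hGs : ∀ x, G x ≠ 0 → |x| ≤ 1 / 16 := fun x hx => by
    have : x ∈ Function.support G := hx
    rw [G.support_eq] at this
    have h := (Metric.mem_ball.1 this).le
    rwa [Real.dist_eq, sub_zero] at h
  have hpos : ∀ x, 0 ≤ G x := fun x => G.nonneg
  have hi : Integrable ((G : ℝ → ℝ) ⋆[ContinuousLinearMap.mul ℝ ℝ] G) :=
    hGi.integrable_convolution _ hGi
  refine ⟨(G : ℝ → ℝ) ⋆[ContinuousLinearMap.mul ℝ ℝ] G,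
    hGc.contDiff_convolution_left (n := ⊤) _ G.contDiff G.continuous.locallyIntegrable,
    fun x => integral_nonneg fun y => mul_nonneg (hpos _) (hpos _), fun x => ?_, fun x hx => ?_,
    fun ξ => ?_, ?_⟩
  · rw [convolution_def, convolution_def, ← integral_neg_eq_self]
    congr 1
    ext y
    rw [G.neg, show -x - -y = -(x - y) by ring, G.neg]
  · by_contra hlt
    apply hx
    refine integral_eq_zero_of_ae (ae_of_all _ fun y => ?_)
    simp only [ContinuousLinearMap.mul_apply', Pi.zero_apply]
    by_contra hne
    have a1 := hGs y (left_ne_zero_of_mul hne)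
    have a2 := hGs _ (right_ne_zero_of_mul hne)
    apply hlt
    calc |x| = |y + (x - y)| := by ring_nf
      _ ≤ |y| + |x - y| := abs_add_le _ _
      _ ≤ _ := by linarith
  -- Since `G` is even its transform is real, and the transform of `G * G` is a square.
  · rw [← realFourier_re hi, realFourier_convolution hGi hGi, Complex.mul_re,
      realFourier_im_of_even hGi fun x => G.neg x]
    nlinarith [mul_self_nonneg (realFourier G ξ).re]
  · rw [integral_convolution _ hGi hGi]
    have : 0 < ∫ x, G x := G.integral_pos
    exact mul_pos this this

/-- Nonvanishing coefficients that decay faster than any geometric sequence. -/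
theorem summable_exp_neg_sq_mul_pow {b : ℝ} (hb : 1 ≤ b) :
    Summable fun j : ℕ => Real.exp (-(j : ℝ) ^ 2) * b ^ j := by
  have h0 : 0 < b := by linarith
  have h1 : Summable fun j : ℕ => Real.exp ((Real.log b + 1) ^ 2 / 4) * Real.exp (-(j : ℝ)) :=
    Real.summable_exp_neg_nat.mul_left _
  refine Summable.of_nonneg_of_le (fun j => by positivity) (fun j => ?_) h1
  rw [← Real.exp_log h0, ← Real.exp_nat_mul, Real.log_exp, ← Real.exp_add, ← Real.exp_add]
  apply Real.exp_le_exp.2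
  -- Completing the square: `j * log b - j ^ 2 ≤ (log b + 1) ^ 2 / 4 - j`.
  nlinarith [sq_nonneg ((j : ℝ) - (Real.log b + 1) / 2)]

/-- The lacunary cosine series `∑ⱼ e^{-j²} (1 + cos (2π 3^j x))`. -/
noncomputable def lacunary (x : ℝ) : ℝ :=
  ∑' j : ℕ, Real.exp (-(j : ℝ) ^ 2) * (1 + Real.cos (2 * Real.pi * 3 ^ j * x))

theorem summable_exp_neg_sq : Summable fun j : ℕ => Real.exp (-(j : ℝ) ^ 2) := by
  simpa using summable_exp_neg_sq_mul_pow le_rfl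

theorem contDiff_lacunary : ContDiff ℝ ∞ lacunary := by
  have e : lacunary = fun x => ∑' j : ℕ, Real.exp (-(j : ℝ) ^ 2) +
      ∑' j : ℕ, Real.exp (-(j : ℝ) ^ 2) * Real.cos (2 * Real.pi * 3 ^ j * x) := by
    ext x
    have h2 : Summable fun j : ℕ => Real.exp (-(j : ℝ) ^ 2) *
        Real.cos (2 * Real.pi * 3 ^ j * x) := by
      refine Summable.of_norm_bounded summable_exp_neg_sq fun j => ?_
      rw [norm_mul, Real.norm_of_nonneg (Real.exp_nonneg _)]
      exact mul_le_of_le_one_right (Real.exp_nonneg _) (Real.abs_cos_le_one _)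
    rw [← summable_exp_neg_sq.tsum_add h2, lacunary]
    simp only [mul_add, mul_one]
  rw [e]
  -- The `k`-th derivative costs `(2π * 3 ^ j) ^ k`, geometric in `j`, which `exp (-j ^ 2)` beats
  -- for every `k`.
  refine contDiff_const.add (contDiff_tsum (N := ⊤)
    (f := fun (j : ℕ) (x : ℝ) => Real.exp (-(j : ℝ) ^ 2) * Real.cos (2 * Real.pi * 3 ^ j * x))
    (v := fun k j => (2 * Real.pi) ^ k * (Real.exp (-(j : ℝ) ^ 2) * (3 ^ k) ^ j))
    (fun j => by fun_prop) (fun k _ => ?_) fun k j x _ => ?_)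
  · exact (summable_exp_neg_sq_mul_pow (one_le_pow₀ (by norm_num))).mul_left _
  · rw [norm_iteratedFDeriv_eq_norm_iteratedDeriv, iteratedDeriv_const_mul_field,
      iteratedDeriv_comp_const_mul Real.contDiff_cos]
    rw [norm_mul, norm_mul, Real.norm_of_nonneg (Real.exp_nonneg _),
      Real.norm_of_nonneg (by positivity), mul_pow, ← pow_mul, ← pow_mul, mul_comm k j]
    have := Real.abs_iteratedDeriv_cos_le_one k (2 * Real.pi * 3 ^ j * x)
    calc _ ≤ Real.exp (-(j : ℝ) ^ 2) * ((2 * Real.pi) ^ k * 3 ^ (j * k) * 1) := by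
          gcongr
          exact this
      _ = _ := by ring

theorem lacunary_term_nonneg (j : ℕ) (x : ℝ) :
    0 ≤ Real.exp (-(j : ℝ) ^ 2) * (1 + Real.cos (2 * Real.pi * 3 ^ j * x)) :=
  mul_nonneg (Real.exp_nonneg _) (by linarith [Real.neg_one_le_cos (2 * Real.pi * 3 ^ j * x)])

theorem lacunary_nonneg (x : ℝ) : 0 ≤ lacunary x := tsum_nonneg fun j => lacunary_term_nonneg j x

theorem lacunary_neg (x : ℝ) : lacunary (-x) = lacunary x := by
  simp only [lacunary, mul_neg, Real.cos_neg]

/-- Multiplying a kernel with nonnegative cosine transform by the lacunary series keeps the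
transform at `±3^j` and at `0` large. -/
theorem le_integral_mul_lacunary_mul_cos {χ : ℝ → ℝ} (hχ : Integrable χ)
    (hX : ∀ ξ, 0 ≤ ∫ x, χ x * Real.cos (2 * Real.pi * ξ * x)) (ξ : ℝ) (j : ℕ)
    (hξ : ξ = 0 ∨ ξ = 3 ^ j) :
    Real.exp (-(j : ℝ) ^ 2) / 2 * ∫ x, χ x ≤
      ∫ x, χ x * lacunary x * Real.cos (2 * Real.pi * ξ * x) := by
  have hc : ∀ η, Integrable fun x => χ x * Real.cos (2 * Real.pi * η * x) := fun η =>
    hχ.mul_bdd (c := 1) (by fun_prop) (ae_of_all _ fun x => Real.abs_cos_le_one _)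
  -- Product-to-sum form of the `k`-th term: its integral combines transforms of `χ` at `ξ` and `ξ ±
  -- 3 ^ k`, all nonnegative. Thus the term `k = j` alone bounds the sum from below.
  let F : ℕ → ℝ → ℝ := fun k x => Real.exp (-(k : ℝ) ^ 2) *
    (χ x * Real.cos (2 * Real.pi * ξ * x) + (χ x * Real.cos (2 * Real.pi * (ξ - 3 ^ k) * x) +
      χ x * Real.cos (2 * Real.pi * (ξ + 3 ^ k) * x)) / 2)
  have hFi : ∀ k, Integrable (F k) := fun k =>
    ((hc _).add (((hc _).add (hc _)).div_const 2)).const_mul _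
  have hFint : ∀ k, ∫ x, F k x = Real.exp (-(k : ℝ) ^ 2) *
      ((∫ x, χ x * Real.cos (2 * Real.pi * ξ * x)) +
        ((∫ x, χ x * Real.cos (2 * Real.pi * (ξ - 3 ^ k) * x)) +
          ∫ x, χ x * Real.cos (2 * Real.pi * (ξ + 3 ^ k) * x)) / 2) := fun k => by
    have h1 := integral_add (hc (ξ - 3 ^ k)) (hc (ξ + 3 ^ k))
    have h2 := integral_add (hc ξ) (((hc (ξ - 3 ^ k)).add (hc (ξ + 3 ^ k))).div_const 2)
    simp only [Pi.add_apply, integral_div] at h2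
    rw [integral_const_mul, h2, h1]
  have hF : ∀ k x, F k x = (Real.exp (-(k : ℝ) ^ 2) *
      (1 + Real.cos (2 * Real.pi * 3 ^ k * x))) * (χ x * Real.cos (2 * Real.pi * ξ * x)) := by
    intro k x
    have := Real.cos_add (2 * Real.pi * ξ * x) (2 * Real.pi * 3 ^ k * x)
    have h' := Real.cos_sub (2 * Real.pi * ξ * x) (2 * Real.pi * 3 ^ k * x)
    have e1 : 2 * Real.pi * (ξ - 3 ^ k) * x = 2 * Real.pi * ξ * x - 2 * Real.pi * 3 ^ k * x := by
      ring
    have e2 : 2 * Real.pi * (ξ + 3 ^ k) * x = 2 * Real.pi * ξ * x + 2 * Real.pi * 3 ^ k * x := by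
      ring
    simp only [F]
    rw [e1, e2, this, h']
    ring
  have hFs : Summable fun k => ∫ x, ‖F k x‖ := by
    refine Summable.of_nonneg_of_le (fun k => integral_nonneg fun x => norm_nonneg _) (fun k => ?_)
      (summable_exp_neg_sq.mul_right (2 * ∫ x, |χ x|))
    rw [← integral_const_mul, ← integral_const_mul]
    refine integral_mono_of_nonneg (ae_of_all _ fun x => norm_nonneg _)
      ((hχ.abs.const_mul _).const_mul _) (ae_of_all _ fun x => ?_)
    simp only [hF, norm_mul, Real.norm_eq_abs, Real.abs_exp]
    have h1 := Real.abs_cos_le_one (2 * Real.pi * ξ * x)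
    have h2 : |1 + Real.cos (2 * Real.pi * 3 ^ k * x)| ≤ 2 := by
      rw [abs_le]
      constructor <;> linarith [Real.neg_one_le_cos (2 * Real.pi * 3 ^ k * x),
        Real.cos_le_one (2 * Real.pi * 3 ^ k * x)]
    calc _ ≤ Real.exp (-(k : ℝ) ^ 2) * 2 * (|χ x| * 1) := by gcongr
      _ = _ := by ring
  have hsum := hasSum_integral_of_summable_integral_norm hFi hFs
  have e : (fun x => ∑' k, F k x) =
      fun x => χ x * lacunary x * Real.cos (2 * Real.pi * ξ * x) := by
    ext x
    simp only [hF, tsum_mul_right]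
    rw [lacunary]
    ring
  rw [e] at hsum
  have hnn : ∀ k, 0 ≤ ∫ x, F k x := fun k => by
    rw [hFint]
    have h1 := hX ξ
    have h2 := hX (ξ - 3 ^ k)
    have h3 := hX (ξ + 3 ^ k)
    positivity
  refine le_trans ?_ (le_hasSum hsum j fun k _ => hnn k)
  rw [hFint, div_mul_eq_mul_div, mul_div_assoc]
  refine mul_le_mul_of_nonneg_left ?_ (Real.exp_nonneg _)
  have h1 := hX ξ
  have h2 := hX (ξ - 3 ^ j)
  have h3 := hX (ξ + 3 ^ j)
  -- One of the frequencies `ξ`, `ξ - 3 ^ j` is zero, where the transform of `χ` is its full mass;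
  -- the smaller of the two coefficients is `1 / 2`.
  rcases hξ with h | h
  · have e0 : ∫ x, χ x * Real.cos (2 * Real.pi * ξ * x) = ∫ x, χ x := by simp [h]
    rw [e0] at h1 ⊢
    linarith
  · have e0 : ∫ x, χ x * Real.cos (2 * Real.pi * (ξ - 3 ^ j) * x) = ∫ x, χ x := by simp [h]
    rw [e0] at h2 ⊢
    linarith

theorem exp_neg_sq_le_one_sub {x : ℝ} (hx : |x| ≤ 1) : Real.exp (-x ^ 2) ≤ 1 - x ^ 2 / 2 := by
  have h0 : x ^ 2 ≤ 1 := by rw [← sq_abs]; exact pow_le_one₀ (abs_nonneg _) hx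
  have hp : 0 < 1 - x ^ 2 / 2 := by linarith
  rw [← Real.le_log_iff_exp_le hp]
  refine le_trans ?_ (Real.one_sub_inv_le_log_of_pos hp)
  have : (1 - x ^ 2 / 2)⁻¹ ≤ 1 + x ^ 2 := by
    rw [inv_le_iff_one_le_mul₀ hp]
    nlinarith [sq_nonneg x]
  linarith

/-- There is a bump function whose Fourier transform decays only quasi-polynomially along the
powers of `3`. -/
theorem exists_isBump_fourier_lower_bound : ∃ f : ℝ → ℝ, IsBump f ∧
    (∃ B : ℝ, 0 < B ∧ ∀ j : ℕ, Real.exp (-(B * ((j : ℝ) + 1) ^ 2)) ≤ ‖realFourier f (3 ^ j)‖) ∧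
    ∀ ξ : ℝ, |ξ| ≤ 1 → Real.exp (-ξ ^ 2) ≤ ‖realFourier f ξ‖ := by
  obtain ⟨χ, hs, h0, he, hsupp, hX, hpos⟩ := exists_positive_definite_kernel
  have hχc : HasCompactSupport χ := hasCompactSupport_of_abs_le hsupp
  have hχi : Integrable χ := hs.continuous.integrable_of_hasCompactSupport hχc
  set X := ∫ x, χ x with hXdef
  set Z := ∫ x, χ x * lacunary x with hZdef
  have hZ : 0 < Z := by
    have h := le_integral_mul_lacunary_mul_cos hχi hX 0 0 (Or.inl rfl)
    simp only [mul_zero, zero_mul, Real.cos_zero, mul_one] at h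
    exact lt_of_lt_of_le (by positivity) h
  let f : ℝ → ℝ := fun x => χ x * lacunary x / Z
  have hfs : ∀ x, f x ≠ 0 → |x| ≤ 1 / 8 := fun x hx => by
    apply hsupp
    rintro h
    simp [f, h] at hx
  have hfsm : ContDiff ℝ ∞ f := (hs.mul contDiff_lacunary).div_const Z
  have hf : IsBump f := by
    refine ⟨hfsm, fun x => div_nonneg (mul_nonneg (h0 x) (lacunary_nonneg x)) hZ.le,
      fun x => ?_, ?_, ?_⟩
    · simp only [f, he, lacunary_neg]
    · refine closure_minimal (fun x hx => ?_) isClosed_Icc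
      have := abs_le.1 (hfs x hx)
      constructor <;> linarith
    · simp only [f, integral_div]
      exact div_self hZ.ne'
  have hfi : Integrable f := hfsm.continuous.integrable_of_hasCompactSupport hf.hasCompactSupport
  have hre : ∀ ξ, ∫ x, f x * Real.cos (2 * Real.pi * ξ * x) ≤ ‖realFourier f ξ‖ := fun ξ => by
    rw [← realFourier_re hfi]
    exact Complex.re_le_norm _
  refine ⟨f, hf, ⟨1 + |Real.log (X / (2 * Z))|, by positivity, fun j => ?_⟩, fun ξ hξ => ?_⟩
  · refine le_trans ?_ (hre _)
    have h := le_integral_mul_lacunary_mul_cos hχi hX (3 ^ j) j (Or.inr rfl)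
    have e : ∫ x, f x * Real.cos (2 * Real.pi * 3 ^ j * x) =
        (∫ x, χ x * lacunary x * Real.cos (2 * Real.pi * 3 ^ j * x)) / Z := by
      rw [← integral_div]
      congr 1
      ext x
      simp only [f]
      ring
    rw [e]
    refine le_trans ?_ (div_le_div_of_nonneg_right h hZ.le)
    have hq : 0 < X / (2 * Z) := by positivity
    calc Real.exp (-((1 + |Real.log (X / (2 * Z))|) * ((j : ℝ) + 1) ^ 2))
        ≤ Real.exp (-(j : ℝ) ^ 2 + Real.log (X / (2 * Z))) := by
          apply Real.exp_le_exp.2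
          have h1 := neg_abs_le (Real.log (X / (2 * Z)))
          have h2 := abs_nonneg (Real.log (X / (2 * Z)))
          have h3 : (0 : ℝ) ≤ j := Nat.cast_nonneg j
          nlinarith [mul_nonneg h2 h3, mul_nonneg h2 (mul_nonneg h3 h3)]
      _ = _ := by
          rw [Real.exp_add, Real.exp_log hq]
          field_simp
          rw [hXdef]
  · refine le_trans ?_ (hre _)
    refine (exp_neg_sq_le_one_sub hξ).trans ?_
    have e : 1 - ξ ^ 2 / 2 = ∫ x, f x * (1 - ξ ^ 2 / 2) := by
      rw [integral_mul_const, hf.integral_eq, one_mul]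
    rw [e]
    refine integral_mono (hfi.mul_const _)
      (hfi.mul_bdd (c := 1) (by fun_prop) (ae_of_all _ fun x => Real.abs_cos_le_one _)) fun x => ?_
    by_cases hx : f x = 0
    · simp [hx]
    refine mul_le_mul_of_nonneg_left ?_ (hf.nonneg x)
    refine le_trans ?_ Real.one_sub_sq_div_two_le_cos
    -- The support radius `1 / 8` and `π < 4` are what make this hold; it turns the quadratic bound
    -- for the cosine into `1 - ξ ^ 2 / 2`.
    have h1 : |2 * Real.pi * x| ≤ 1 := by
      rw [abs_mul, abs_of_pos (by positivity)]
      have := hfs x hx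
      nlinarith [Real.pi_lt_four, Real.pi_pos, abs_nonneg x]
    have h2 : (2 * Real.pi * x) ^ 2 ≤ 1 := by
      rw [← sq_abs]; exact pow_le_one₀ (abs_nonneg _) h1
    nlinarith [mul_le_mul_of_nonneg_left h2 (sq_nonneg ξ)]

/-! ### The Fourier transform of the infinite convolution as a product. -/

section Fourier

variable {f : ℝ → ℝ} {r : ℕ → ℝ} {ψ : ℝ → ℝ}

theorem realFourier_rescale (f : ℝ → ℝ) {r : ℝ} (hr : 0 < r) (ξ : ℝ) :
    realFourier (rescale f r) ξ = realFourier f (r * ξ) := by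
  have h := Measure.integral_comp_div
    (fun y : ℝ => Complex.exp ((-2 * Real.pi * y * (r * ξ) : ℝ) * Complex.I) * (f y : ℂ)) r
  have hr' : (r : ℂ) ≠ 0 := by exact_mod_cast hr.ne'
  have e : realFourier f (r * ξ) = (1 / r : ℂ) * ∫ x : ℝ,
      Complex.exp ((-2 * Real.pi * (x / r) * (r * ξ) : ℝ) * Complex.I) * (f (x / r) : ℂ) := by
    rw [h, realFourier_eq, abs_of_pos hr, Complex.real_smul, ← mul_assoc, one_div_mul_cancel hr',
      one_mul]
  rw [e, realFourier_eq, ← integral_const_mul]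
  congr 1
  ext x
  rw [show -2 * Real.pi * (x / r) * (r * ξ) = -2 * Real.pi * x * ξ by field_simp, rescale]
  push_cast
  ring

theorem realFourier_partialConv (hf : IsBump f) (hr : ∀ p, 0 < r p) (p : ℕ) (ξ : ℝ) :
    realFourier (partialConv f r p) ξ =
      ∏ k ∈ Finset.range (p + 1), realFourier f (r k * ξ) := by
  induction p with
  | zero => simp [partialConv, realFourier_rescale f (hr 0)]
  | succ p ih =>
    rw [Finset.prod_range_succ, ← ih, ← realFourier_rescale f (hr (p + 1))]
    exact realFourier_convolution ((contDiff_partialConv hf hr p).continuous.integrable_of_hasCompactSupport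
      (hasCompactSupport_partialConv hf hr p))
      (hf.contDiff_rescale.continuous.integrable_of_hasCompactSupport
        (hf.hasCompactSupport_rescale (hr _))) ξ

/-- Dominated convergence: all stages share the stage-`0` sup bound and live in one compact
interval. -/
theorem IsInfiniteConv.tendsto_realFourier (h : IsInfiniteConv f r ψ) (hf : IsBump f)
    (hr : ∀ p, 0 < r p) (hs : Summable r) (ξ : ℝ) :
    Tendsto (fun p => realFourier (partialConv f r p) ξ) atTop (𝓝 (realFourier ψ ξ)) := by
  obtain ⟨G, hG⟩ := exists_abs_le_of_hasCompactSupport (contDiff_partialConv hf hr 0).continuous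
    (hasCompactSupport_partialConv hf hr 0)
  have hG' : ∀ p x, |partialConv f r p x| ≤ G := fun p x => by
    have := abs_iteratedDeriv_partialConv_le_of_le (n := 0) hf hr (Nat.zero_le p)
      (by simpa using hG) x
    simpa using this
  simp only [realFourier_eq]
  refine tendsto_integral_of_dominated_convergence
    (Set.indicator (Set.Icc (-∑' p, r p) (∑' p, r p)) fun _ => G) (fun p => ?_) ?_
    (fun p => ae_of_all _ fun x => ?_) (ae_of_all _ fun x => ?_)
  · have := (contDiff_partialConv hf hr p).continuous
    exact Continuous.aestronglyMeasurable (by fun_prop)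
  · exact (integrableOn_const (by simp)).integrable_indicator measurableSet_Icc
  · rw [norm_mul, Complex.norm_exp_ofReal_mul_I, one_mul, Complex.norm_real, Real.norm_eq_abs]
    by_cases hx : partialConv f r p x = 0
    · rw [hx, abs_zero]
      exact Set.indicator_nonneg (fun _ _ => (abs_nonneg _).trans (hG 0)) x
    · have hm : x ∈ Set.Icc (-∑' p, r p) (∑' p, r p) :=
        abs_le.1 (abs_le_of_partialConv_ne_zero hf hr hs le_rfl hx)
      rw [Set.indicator_of_mem hm]
      exact hG' p x
  · exact ((Complex.continuous_ofReal.tendsto _).comp (h.tendsto x)).const_mul _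

theorem IsInfiniteConv.integral_eq_one (h : IsInfiniteConv f r ψ) (hf : IsBump f)
    (hr : ∀ p, 0 < r p) (hs : Summable r) : ∫ x, ψ x = 1 := by
  have h1 := h.tendsto_realFourier hf hr hs 0
  have h2 : ∀ p, realFourier (partialConv f r p) 0 = 1 := fun p => by
    rw [realFourier_partialConv hf hr]
    simp [realFourier_zero, hf.integral_eq]
  simp only [h2, realFourier_zero] at h1
  exact_mod_cast (tendsto_nhds_unique h1 tendsto_const_nhds)

theorem IsInfiniteConv.exp_neg_tsum_le_realFourier (h : IsInfiniteConv f r ψ) (hf : IsBump f)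
    (hr : ∀ p, 0 < r p) (hs : Summable r) {ξ : ℝ} {b : ℕ → ℝ} (hb0 : ∀ p, 0 ≤ b p)
    (hb : Summable b) (hbf : ∀ p, Real.exp (-b p) ≤ ‖realFourier f (r p * ξ)‖) :
    Real.exp (-∑' p, b p) ≤ ‖realFourier ψ ξ‖ := by
  refine ge_of_tendsto' (h.tendsto_realFourier hf hr hs ξ).norm fun p => ?_
  rw [realFourier_partialConv hf hr, norm_prod]
  calc Real.exp (-∑' p, b p) ≤ Real.exp (∑ k ∈ Finset.range (p + 1), -b k) := by
        apply Real.exp_le_exp.2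
        rw [Finset.sum_neg_distrib]
        exact neg_le_neg (hb.sum_le_tsum _ fun k _ => hb0 k)
    _ = ∏ k ∈ Finset.range (p + 1), Real.exp (-b k) := Real.exp_sum _ _
    _ ≤ _ := Finset.prod_le_prod (fun k _ => (Real.exp_pos _).le) fun k _ => hbf k

end Fourier

/-! ### Lower bounds at powers of `3`, and the choice of radii. -/

theorem exists_add_one_pow_mul_geometric_le (Q : ℕ) {q : ℝ} (hq0 : 0 < q) (hq : q < 1) :
    ∃ C : ℝ, 0 < C ∧ ∀ k : ℕ, ((k : ℝ) + 1) ^ Q * q ^ k ≤ C := by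
  have hs : Summable fun n : ℕ => (n : ℝ) ^ Q * q ^ n :=
    summable_pow_mul_geometric_of_norm_lt_one Q (by rwa [Real.norm_of_nonneg hq0.le])
  have hle : ∀ k : ℕ, ((k : ℝ) + 1) ^ Q * q ^ (k + 1) ≤ ∑' n : ℕ, (n : ℝ) ^ Q * q ^ n := fun k => by
    have := hs.le_tsum (k + 1) fun j _ => by positivity
    simpa using this
  refine ⟨(∑' n : ℕ, (n : ℝ) ^ Q * q ^ n) / q, ?_, fun k => ?_⟩
  · refine div_pos (lt_of_lt_of_le ?_ (hle 0)) hq0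
    positivity
  · rw [le_div_iff₀ hq0, mul_assoc, ← pow_succ]
    exact hle k

/-- One bound covers both regimes, with a factor in `e` that becomes summable along the radii. If `e
≤ m`, then `(e + 1) ^ Q ≤ (m + 1) ^ Q` and the bound at `3 ^ (m - e)` suffices. If `e = m + k`, the
exponent `9 ^ (-k)` near the origin beats `(k + 1) ^ Q`, because `e + 1 ≤ (m + 1) * (k + 1)`. -/
theorem exists_exp_neg_le_realFourier {f : ℝ → ℝ} {B : ℝ} (hB : 0 < B)
    (h1 : ∀ j : ℕ, Real.exp (-(B * ((j : ℝ) + 1) ^ 2)) ≤ ‖realFourier f (3 ^ j)‖)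
    (h2 : ∀ ξ : ℝ, |ξ| ≤ 1 → Real.exp (-ξ ^ 2) ≤ ‖realFourier f ξ‖) (Q : ℕ) :
    ∃ C : ℝ, 0 < C ∧ ∀ m e : ℕ,
      Real.exp (-(C * ((m : ℝ) + 1) ^ (Q + 2) * (1 / ((e : ℝ) + 1) ^ Q))) ≤
        ‖realFourier f (3 ^ m / 3 ^ e)‖ := by
  obtain ⟨C, hC, hCk⟩ := exists_add_one_pow_mul_geometric_le Q (q := 1 / 9) (by norm_num)
    (by norm_num)
  refine ⟨B + C, by positivity, fun m e => ?_⟩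
  have hm1 : (1 : ℝ) ≤ (m : ℝ) + 1 := by linarith [(Nat.cast_nonneg m : (0 : ℝ) ≤ m)]
  rcases le_or_gt e m with hem | hem
  · obtain ⟨j, rfl⟩ := Nat.exists_eq_add_of_le hem
    have e1 : (3 : ℝ) ^ (e + j) / 3 ^ e = 3 ^ j := by rw [pow_add]; field_simp
    rw [e1]
    refine le_trans (Real.exp_le_exp.2 (neg_le_neg ?_)) (h1 j)
    have he : ((e : ℝ) + 1) ^ Q ≤ (((e + j : ℕ) : ℝ) + 1) ^ Q := by
      push_cast; gcongr; linarith [(Nat.cast_nonneg j : (0 : ℝ) ≤ j)]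
    have hj : ((j : ℝ) + 1) ^ 2 ≤ (((e + j : ℕ) : ℝ) + 1) ^ 2 := by
      push_cast; gcongr; linarith [(Nat.cast_nonneg e : (0 : ℝ) ≤ e)]
    rw [mul_one_div, le_div_iff₀ (by positivity), pow_add, mul_assoc,
      mul_comm ((_ : ℝ) ^ 2) ((_ : ℝ) ^ Q)]
    exact mul_le_mul (by linarith) (mul_le_mul he hj (by positivity) (by positivity))
      (by positivity) (by positivity)
  · obtain ⟨k, rfl⟩ := Nat.exists_eq_add_of_le hem.le
    have e1 : (3 : ℝ) ^ m / 3 ^ (m + k) = (1 / 3) ^ k := by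
      rw [pow_add, one_div, inv_pow]; field_simp
    rw [e1]
    have hle : |((1 : ℝ) / 3) ^ k| ≤ 1 := by
      rw [abs_of_pos (by positivity)]
      exact pow_le_one₀ (by norm_num) (by norm_num)
    refine le_trans (Real.exp_le_exp.2 (neg_le_neg ?_)) (h2 _ hle)
    have e2 : (((1 : ℝ) / 3) ^ k) ^ 2 = (1 / 9) ^ k := by
      rw [← pow_mul, mul_comm, pow_mul]; norm_num
    rw [e2, mul_one_div, le_div_iff₀ (by positivity)]
    have hmk : (((m + k : ℕ) : ℝ) + 1) ^ Q ≤ (((m : ℝ) + 1) * ((k : ℝ) + 1)) ^ Q := by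
      push_cast
      gcongr
      nlinarith [(Nat.cast_nonneg k : (0 : ℝ) ≤ k), (Nat.cast_nonneg m : (0 : ℝ) ≤ m)]
    have hm2 : ((m : ℝ) + 1) ^ Q ≤ ((m : ℝ) + 1) ^ (Q + 2) := pow_le_pow_right₀ hm1 (by omega)
    calc (1 / 9 : ℝ) ^ k * (((m + k : ℕ) : ℝ) + 1) ^ Q
        ≤ (1 / 9 : ℝ) ^ k * (((m : ℝ) + 1) * ((k : ℝ) + 1)) ^ Q := by gcongr
      _ = (((k : ℝ) + 1) ^ Q * (1 / 9 : ℝ) ^ k) * ((m : ℝ) + 1) ^ Q := by rw [mul_pow]; ring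
      _ ≤ (B + C) * ((m : ℝ) + 1) ^ (Q + 2) := by
          refine mul_le_mul ((hCk k).trans (by linarith)) hm2 (by positivity) (by positivity)

/-- Exponents of the radii of the infinite convolution. -/
noncomputable def radiusExponent (s : ℝ) (p : ℕ) : ℕ := ⌈((p : ℝ) + 1) ^ s⌉₊

theorem le_radiusExponent (s : ℝ) (p : ℕ) : ((p : ℝ) + 1) ^ s ≤ radiusExponent s p := Nat.le_ceil _

theorem radiusExponent_le {s : ℝ} (hs : 0 < s) (p : ℕ) :
    (radiusExponent s p : ℝ) ≤ 2 * ((p : ℝ) + 1) ^ s := by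
  have h1 : (1 : ℝ) ≤ ((p : ℝ) + 1) ^ s :=
    Real.one_le_rpow (by linarith [(Nat.cast_nonneg p : (0 : ℝ) ≤ p)]) hs.le
  have := (Nat.ceil_lt_add_one (a := ((p : ℝ) + 1) ^ s) (by linarith)).le
  unfold radiusExponent
  linarith

theorem summable_inv_radiusExponent_pow {s : ℝ} {Q : ℕ} (hQ : 2 ≤ Q * s) :
    Summable fun p : ℕ => 1 / ((radiusExponent s p : ℝ) + 1) ^ Q := by
  have h : Summable fun p : ℕ => 1 / ((p : ℝ) + 1) ^ 2 := by
    have := (summable_nat_add_iff 1).2 (Real.summable_one_div_nat_pow.2 one_lt_two)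
    simpa using this
  refine Summable.of_nonneg_of_le (fun p => by positivity) (fun p => ?_) h
  have hp : (1 : ℝ) ≤ (p : ℝ) + 1 := by linarith [(Nat.cast_nonneg p : (0 : ℝ) ≤ p)]
  refine one_div_le_one_div_of_le (by positivity) ?_
  calc ((p : ℝ) + 1) ^ 2 = ((p : ℝ) + 1) ^ (2 : ℝ) := by norm_cast
    _ ≤ ((p : ℝ) + 1) ^ (s * Q) := Real.rpow_le_rpow_of_exponent_le hp (by linarith)
    _ = (((p : ℝ) + 1) ^ s) ^ Q := by rw [Real.rpow_mul (by positivity), Real.rpow_natCast]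
    _ ≤ _ := by
      gcongr
      linarith [le_radiusExponent s p]

theorem summable_radius {s : ℝ} (hs : 0 < s) :
    Summable fun p : ℕ => ((1 : ℝ) / 3) ^ radiusExponent s p := by
  obtain ⟨Q, hQ⟩ := exists_nat_ge (2 / s)
  rw [div_le_iff₀ hs] at hQ
  obtain ⟨C, hC, hCk⟩ := exists_add_one_pow_mul_geometric_le Q (q := 1 / 3) (by norm_num)
    (by norm_num)
  refine Summable.of_nonneg_of_le (fun p => by positivity) (fun p => ?_)
    ((summable_inv_radiusExponent_pow hQ).mul_left C)
  rw [mul_one_div, le_div_iff₀ (by positivity), mul_comm]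
  exact hCk _

/-! ### Gevrey bounds against Fourier lower bounds. -/

/-- Fourier decay of a compactly supported function with Gevrey bounds. -/
theorem pow_mul_norm_realFourier_le {ψ : ℝ → ℝ} (hψ : ContDiff ℝ ∞ ψ) {a : ℝ} (ha : 0 < a)
    (hsupp : ∀ x, ψ x ≠ 0 → |x| ≤ a) {n : ℕ} {D : ℝ}
    (hD : ∀ x, |x| ≤ a → |iteratedDeriv n ψ x| ≤ D) (ξ : ℝ) :
    |ξ| ^ n * ‖realFourier ψ ξ‖ ≤ 2 * a * D := by
  have hψc : HasCompactSupport ψ := hasCompactSupport_of_abs_le hsupp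
  have hD0 : 0 ≤ D := (abs_nonneg _).trans (hD 0 (by simpa using ha.le))
  have hcd : ∀ k, iteratedDeriv k (fun x => (ψ x : ℂ)) = fun x => ((iteratedDeriv k ψ x : ℝ) : ℂ) := by
    intro k
    induction k with
    | zero => simp
    | succ k ih =>
      rw [iteratedDeriv_succ, ih, iteratedDeriv_succ]
      ext x
      have hd : DifferentiableAt ℝ (iteratedDeriv k ψ) x :=
        (contDiff_iteratedDeriv hψ k).differentiable (by simp) x
      exact hd.hasDerivAt.ofReal_comp.deriv
  have hint : ∀ k, Integrable (iteratedDeriv k ψ) := fun k =>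
    (contDiff_iteratedDeriv hψ k).continuous.integrable_of_hasCompactSupport
      (hasCompactSupport_iteratedDeriv hψc k)
  have hC : ContDiff ℝ ((⊤ : ℕ∞) : WithTop ℕ∞) (fun x => (ψ x : ℂ)) := Complex.ofRealCLM.contDiff.comp hψ
  have hF := Real.fourier_iteratedDeriv (N := ⊤) (n := n) hC
    (fun k _ => by rw [hcd]; exact (hint k).ofReal) le_top
  have hF' := congrArg norm (congrFun hF ξ)
  rw [hcd] at hF'
  have e : ‖(2 * Real.pi * Complex.I * ξ : ℂ) ^ n • 𝓕 (fun x => (ψ x : ℂ)) ξ‖ =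
      (2 * Real.pi * |ξ|) ^ n * ‖realFourier ψ ξ‖ := by
    rw [norm_smul, norm_pow]
    congr 2
    simp [abs_of_pos Real.pi_pos]
  rw [e] at hF'
  have hsub : tsupport ψ ⊆ Set.Icc (-a) a :=
    closure_minimal (fun x hx => abs_le.1 (hsupp x hx)) isClosed_Icc
  have hz : ∀ x, x ∉ Set.Icc (-a) a → iteratedDeriv n ψ x = 0 := fun x hx => by
    by_contra hne
    have h1 : x ∈ tsupport (iteratedDeriv n ψ) := subset_tsupport _ hne
    have h2 : ∀ k, tsupport (iteratedDeriv k ψ) ⊆ tsupport ψ := fun k => by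
      induction k with
      | zero => simp
      | succ k ih =>
        rw [iteratedDeriv_succ]
        exact (closure_minimal (support_deriv_subset) (isClosed_tsupport _)).trans ih
    exact hx (hsub (h2 n h1))
  have hup : ‖realFourier (iteratedDeriv n ψ) ξ‖ ≤ 2 * a * D := by
    rw [realFourier_eq]
    refine (norm_integral_le_integral_norm _).trans ?_
    have h1 : ∀ x : ℝ, ‖Complex.exp ((-2 * Real.pi * x * ξ : ℝ) * Complex.I) *
        ((iteratedDeriv n ψ x : ℝ) : ℂ)‖ ≤ Set.indicator (Set.Icc (-a) a) (fun _ => D) x := fun x => by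
      rw [norm_mul, Complex.norm_exp_ofReal_mul_I, one_mul, Complex.norm_real, Real.norm_eq_abs]
      by_cases hx : x ∈ Set.Icc (-a) a
      · rw [Set.indicator_of_mem hx]; exact hD x (abs_le.2 hx)
      · rw [Set.indicator_of_notMem hx, hz x hx, abs_zero]
    refine (integral_mono_of_nonneg (ae_of_all _ fun x => norm_nonneg _)
      ((integrableOn_const (by simp)).integrable_indicator measurableSet_Icc)
      (ae_of_all _ h1)).trans ?_
    rw [integral_indicator measurableSet_Icc, setIntegral_const, smul_eq_mul, Measure.real,
      Real.volume_Icc, ENNReal.toReal_ofReal (by linarith)]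
    linarith
  refine le_trans ?_ hup
  change _ ≤ ‖𝓕 (fun x => ((iteratedDeriv n ψ x : ℝ) : ℂ)) ξ‖
  rw [hF']
  refine mul_le_mul_of_nonneg_right (pow_le_pow_left₀ (abs_nonneg _) ?_ n) (norm_nonneg _)
  nlinarith [Real.pi_gt_three, abs_nonneg ξ]

/-- A quasi-polynomial lower bound for the Fourier transform along a geometric sequence is
incompatible with Gevrey bounds. -/
theorem not_gevrey_of_fourier_lower_bound {ψ : ℝ → ℝ} (hψ : ContDiff ℝ ∞ ψ) {a : ℝ} (ha : 0 < a)
    (hsupp : ∀ x, ψ x ≠ 0 → |x| ≤ a) {ρ C : ℝ} (hρ : 0 < ρ) (k : ℕ)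
    (hlow : ∀ m : ℕ, Real.exp (-(C * ((m : ℝ) + 1) ^ k)) ≤ ‖realFourier ψ (3 ^ m / ρ)‖)
    {t h A : ℝ} (ht : 0 ≤ t) (hh : 0 < h) (hA : 0 < A)
    (hG : ∀ n x, |x| ≤ a → |iteratedDeriv n ψ x| ≤ A * h ^ n * (n.factorial : ℝ) ^ t) : False := by
  -- With `n = M ^ (k + 1)` derivatives below, `(n !) ^ t ≤ (n ^ t) ^ n ≤ (M ^ K) ^ n`.
  obtain ⟨K, hK⟩ := exists_nat_ge (((k + 1 : ℕ) : ℝ) * t)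
  have hlim : Tendsto (fun m : ℕ => ((m : ℝ) + 1) ^ K * (1 / 3 : ℝ) ^ m) atTop (𝓝 0) := by
    have h1 := (tendsto_pow_const_mul_const_pow_of_lt_one K (r := 1 / 3) (by norm_num)
      (by norm_num)).comp (tendsto_add_atTop_nat 1)
    have h2 := h1.mul_const 3
    simp only [zero_mul] at h2
    refine h2.congr fun m => ?_
    simp only [Function.comp_def, pow_succ]
    push_cast
    ring
  have hev : ∀ᶠ m : ℕ in atTop,
      ((m : ℝ) + 1) ^ K * (1 / 3 : ℝ) ^ m < 1 / (ρ * h * Real.exp 1) :=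
    hlim.eventually (gt_mem_nhds (by positivity))
  have hev2 : ∀ᶠ m : ℕ in atTop, C + |Real.log (2 * a * A)| < (m : ℝ) :=
    tendsto_natCast_atTop_atTop.eventually (eventually_gt_atTop _)
  obtain ⟨m, hm1, hm2⟩ := (hev.and hev2).exists
  set M : ℝ := (m : ℝ) + 1 with hM
  have hM1 : 1 ≤ M := by rw [hM]; linarith [(Nat.cast_nonneg m : (0 : ℝ) ≤ m)]
  -- One power more than in the lower bound, so that a gain of `e ^ n` defeats the loss `exp (-C * M
  -- ^ k)`.
  set n : ℕ := (m + 1) ^ (k + 1) with hn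
  have hnM : (n : ℝ) = M ^ (k + 1) := by rw [hn, hM]; push_cast; ring
  have hfac : (n.factorial : ℝ) ^ t ≤ (M ^ K) ^ n := by
    calc (n.factorial : ℝ) ^ t ≤ ((n : ℝ) ^ n) ^ t := by
          gcongr
          exact_mod_cast Nat.factorial_le_pow n
      _ = ((n : ℝ) ^ t) ^ n := by
          rw [← Real.rpow_natCast, ← Real.rpow_mul (by positivity), mul_comm,
            Real.rpow_mul (by positivity), Real.rpow_natCast]
      _ ≤ (M ^ K) ^ n := by
          gcongr
          rw [hnM, ← Real.rpow_natCast M (k + 1), ← Real.rpow_mul (by positivity),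
            ← Real.rpow_natCast M K]
          exact Real.rpow_le_rpow_of_exponent_le hM1 hK
  have hξ : 0 < (3 : ℝ) ^ m / ρ := by positivity
  have hmain := pow_mul_norm_realFourier_le hψ ha hsupp (hG n) (3 ^ m / ρ)
  rw [abs_of_pos hξ] at hmain
  -- The frequency is exponential in `m` and the Gevrey cost per derivative only polynomial, so each
  -- derivative gains at least a factor `e`.
  have hratio : Real.exp 1 * (h * M ^ K) ≤ 3 ^ m / ρ := by
    rw [lt_div_iff₀ (by positivity), one_div, inv_pow] at hm1
    rw [le_div_iff₀ hρ]
    have h3 : (0 : ℝ) < 3 ^ m := by positivity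
    have := mul_lt_mul_of_pos_right hm1 h3
    field_simp at this
    nlinarith
  have hb : Real.exp 1 ^ n * ((h * M ^ K) ^ n) * Real.exp (-(C * M ^ k)) ≤
      2 * a * A * (h * M ^ K) ^ n := by
    calc Real.exp 1 ^ n * ((h * M ^ K) ^ n) * Real.exp (-(C * M ^ k))
        ≤ (3 ^ m / ρ) ^ n * ‖realFourier ψ (3 ^ m / ρ)‖ := by
          rw [← mul_pow]
          gcongr
          exact hlow m
      _ ≤ 2 * a * (A * h ^ n * (n.factorial : ℝ) ^ t) := hmain
      _ ≤ 2 * a * (A * h ^ n * (M ^ K) ^ n) := by gcongr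
      _ = _ := by rw [mul_pow]; ring
  have hb2 : Real.exp (M ^ (k + 1) - C * M ^ k) ≤ 2 * a * A := by
    have hp : 0 < (h * M ^ K) ^ n := by positivity
    have e : Real.exp (M ^ (k + 1) - C * M ^ k) = Real.exp 1 ^ n * Real.exp (-(C * M ^ k)) := by
      rw [← Real.exp_nat_mul, mul_one, ← Real.exp_add, hnM, sub_eq_add_neg]
    rw [e]
    refine le_of_mul_le_mul_right ?_ hp
    calc _ = _ := by ring
      _ ≤ _ := hb
  have hb3 := (Real.le_log_iff_exp_le (by positivity)).2 hb2
  have h4 := le_abs_self (Real.log (2 * a * A))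
  have h5 := abs_nonneg (Real.log (2 * a * A))
  have h6 : 1 ≤ M ^ k := one_le_pow₀ hM1
  have h7 : M ^ (k + 1) - C * M ^ k = M ^ k * (M - C) := by ring
  rw [h7] at hb3
  have h8 : 0 ≤ M - C := by linarith
  nlinarith

/-! ### Partial derivatives of tensor products. -/

section MultiDeriv

variable {d : ℕ}

theorem partialDeriv_prod {u : Fin d → ℝ → ℝ} (i : Fin d) (hu : Differentiable ℝ (u i)) :
    partialDeriv i (fun x => ∏ j, u j (x j)) =
      fun x => ∏ j, Function.update u i (deriv (u i)) j (x j) := by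
  ext x
  have e : (fun t : ℝ => ∏ j, u j ((x + t • (Pi.single i 1 : Fin d → ℝ)) j)) =
      fun t => u i (x i + t) * ∏ j ∈ Finset.univ.erase i, u j (x j) := by
    ext t
    rw [← Finset.mul_prod_erase _ _ (Finset.mem_univ i)]
    congr 1
    · simp
    · refine Finset.prod_congr rfl fun j hj => ?_
      simp [Pi.single_eq_of_ne (Finset.ne_of_mem_erase hj)]
  rw [partialDeriv, lineDeriv, e, ← Finset.mul_prod_erase _ _ (Finset.mem_univ i)]
  have h1 : HasDerivAt (fun t => u i (x i + t)) (deriv (u i) (x i)) 0 := by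
    have h := (hu (x i + 0)).hasDerivAt.comp_const_add (x i) 0
    simpa using h
  rw [(h1.mul_const _).deriv, Function.update_self]
  congr 1
  refine Finset.prod_congr rfl fun j hj => ?_
  rw [Function.update_of_ne (Finset.ne_of_mem_erase hj)]

theorem iterate_partialDeriv_prod {u : Fin d → ℝ → ℝ} (i : Fin d) (hu : ContDiff ℝ ∞ (u i))
    (n : ℕ) : (partialDeriv i)^[n] (fun x => ∏ j, u j (x j)) =
      fun x => ∏ j, Function.update u i (iteratedDeriv n (u i)) j (x j) := by
  induction n with
  | zero => simp
  | succ n ih =>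
    rw [Function.iterate_succ_apply', ih, partialDeriv_prod]
    · simp [iteratedDeriv_succ]
    · rw [Function.update_self]
      exact (contDiff_iteratedDeriv hu n).differentiable (by simp)

/-- Mixed partial derivatives of a tensor product. -/
theorem multiDeriv_prod {ψ : ℝ → ℝ} (hψ : ContDiff ℝ ∞ ψ) (α : Fin d → ℕ) :
    multiDeriv α (fun x => ∏ j, ψ (x j)) = fun x => ∏ j, iteratedDeriv (α j) ψ (x j) := by
  -- Induction over the coordinates already treated; distinctness ensures that the next factor is
  -- still `ψ`.
  have key : ∀ l : List (Fin d), l.Nodup →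
      l.foldr (fun i g => (partialDeriv i)^[α i] g) (fun x => ∏ j, ψ (x j)) =
        fun x => ∏ j, (if j ∈ l then iteratedDeriv (α j) ψ else ψ) (x j) := by
    intro l
    induction l with
    | nil => intro _; simp
    | cons i l ih =>
      intro hl
      obtain ⟨hi, hl⟩ := List.nodup_cons.1 hl
      rw [List.foldr_cons, ih hl,
        iterate_partialDeriv_prod (u := fun j => if j ∈ l then iteratedDeriv (α j) ψ else ψ) i
          (by simpa [hi] using hψ)]
      ext x
      refine Finset.prod_congr rfl fun j _ => ?_
      by_cases hj : j = i
      · subst hj; simp [hi]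
      · simp [hj]
  rw [multiDeriv, key _ (List.nodup_finRange d)]
  simp

end MultiDeriv

/-! ### Membership in the extended classes, and reduction of Gevrey bounds to one variable. -/

/-- The weights dominate `e^{B N^σ}`, with any geometric factor `h^{N^σ}`. -/
theorem exists_exp_rpow_le_weight {τ σ h : ℝ} (hτ : 0 < τ) (hσ : 1 < σ) (hh : 0 < h) (B : ℝ) :
    ∃ C : ℝ, 0 < C ∧ ∀ N : ℕ, Real.exp (B * (N : ℝ) ^ σ) ≤
      C * h ^ ((N : ℝ) ^ σ) * weight τ σ N := by
  set b := B - Real.log h with hb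
  -- Beyond `R` the term `τ * log N` exceeds `b`; only `N ≤ R` needs the constant.
  set R := Real.exp (b / τ) with hR
  refine ⟨Real.exp (R ^ σ * |b|), Real.exp_pos _, fun N => ?_⟩
  rcases Nat.eq_zero_or_pos N with rfl | hN
  · rw [weight_zero τ σ hσ, Nat.cast_zero, Real.zero_rpow (by linarith)]
    have : 0 ≤ R ^ σ * |b| := by positivity
    simpa using this
  have hN' : (0 : ℝ) < N := by exact_mod_cast hN
  set y := (N : ℝ) ^ σ with hy
  have hy0 : 0 ≤ y := by positivity
  rw [weight, ← hy, Real.rpow_def_of_pos hh, Real.rpow_def_of_pos hN', ← Real.exp_add,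
    ← Real.exp_add]
  apply Real.exp_le_exp.2
  have key : y * (b - τ * Real.log N) ≤ R ^ σ * |b| := by
    rcases le_or_gt b (τ * Real.log N) with hle | hlt
    · exact (mul_nonpos_of_nonneg_of_nonpos hy0 (by linarith)).trans (by positivity)
    · have hNR : (N : ℝ) ≤ R := by
        rw [hR, ← Real.log_le_iff_le_exp hN', le_div_iff₀ hτ]
        linarith
      have hlog : 0 ≤ Real.log N := Real.log_nonneg (by exact_mod_cast hN)
      refine mul_le_mul (Real.rpow_le_rpow hN'.le hNR (by linarith)) ?_ (by linarith)
        (by positivity)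
      nlinarith [le_abs_self b]
  nlinarith

theorem isRoumieu_of_isBeurling {d : ℕ} {τ σ : ℝ} {φ : (Fin d → ℝ) → ℝ}
    (h : IsBeurling τ σ φ) : IsRoumieu τ σ φ :=
  ⟨h.1, fun K hK => ⟨1, one_pos, h.2 K hK 1 one_pos⟩⟩

theorem contDiff_prod_apply {d : ℕ} {ψ : ℝ → ℝ} (hψ : ContDiff ℝ ∞ ψ) :
    ContDiff ℝ ∞ fun x : Fin d → ℝ => ∏ i, ψ (x i) :=
  contDiff_prod fun i _ => hψ.comp (contDiff_apply ℝ ℝ i)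

theorem isBeurling_prod {d : ℕ} {τ σ : ℝ} (hτ : 0 < τ) (hσ : 1 < σ) {ψ : ℝ → ℝ}
    (hψ : ContDiff ℝ ∞ ψ) {E B : ℝ} (hE : 0 < E) (hB : 0 ≤ B)
    (hD : ∀ n x, |iteratedDeriv n ψ x| ≤ E * Real.exp (B * (n : ℝ) ^ σ)) :
    IsBeurling τ σ fun x : Fin d → ℝ => ∏ i, ψ (x i) := by
  refine ⟨contDiff_prod_apply hψ, fun K _ h hh => ?_⟩
  obtain ⟨C, hC, hCN⟩ := exists_exp_rpow_le_weight hτ hσ hh (d * B)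
  refine ⟨E ^ d * C, by positivity, fun x _ α => ?_⟩
  rw [multiDeriv_prod hψ]
  calc ‖∏ j, iteratedDeriv (α j) ψ (x j)‖
      = ∏ j, |iteratedDeriv (α j) ψ (x j)| := by rw [norm_prod]; rfl
    _ ≤ ∏ _j : Fin d, E * Real.exp (B * (len α : ℝ) ^ σ) := by
        refine Finset.prod_le_prod (fun j _ => abs_nonneg _) fun j _ => (hD _ _).trans ?_
        have : α j ≤ len α := Finset.single_le_sum (f := α) (fun _ _ => Nat.zero_le _)
          (Finset.mem_univ j)
        have : (α j : ℝ) ≤ len α := by exact_mod_cast this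
        gcongr
    _ = E ^ d * Real.exp (d * B * (len α : ℝ) ^ σ) := by
        rw [Finset.prod_const, Finset.card_univ, Fintype.card_fin, mul_pow, ← Real.exp_nat_mul,
          mul_assoc]
    _ ≤ E ^ d * (C * h ^ ((len α : ℝ) ^ σ) * weight τ σ (len α)) := by
        gcongr
        exact hCN _
    _ = _ := by ring

/-- Gevrey bounds of a tensor power restrict to Gevrey bounds of the factor. -/
theorem IsGevrey.exists_abs_iteratedDeriv_le {d : ℕ} (hd : 1 ≤ d) {t : ℝ} {ψ : ℝ → ℝ}
    (hψ : ContDiff ℝ ∞ ψ) (h : IsGevrey t fun x : Fin d → ℝ => ∏ i, ψ (x i)) {x₀ : ℝ}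
    (hx₀ : ψ x₀ ≠ 0) {a : ℝ} (ha : |x₀| ≤ a) :
    ∃ b : ℝ, 0 < b ∧ ∃ A : ℝ, 0 < A ∧ ∀ (n : ℕ) (x : ℝ), |x| ≤ a →
      |iteratedDeriv n ψ x| ≤ A * b ^ n * (n.factorial : ℝ) ^ t := by
  obtain ⟨b, hb, C, hC, hbd⟩ := h.2 (Set.Icc (fun _ => -a) (fun _ => a)) isCompact_Icc
  let i₀ : Fin d := ⟨0, hd⟩
  have hp : 0 < |ψ x₀| ^ (d - 1) := pow_pos (abs_pos.2 hx₀) _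
  refine ⟨b, hb, C / |ψ x₀| ^ (d - 1), by positivity, fun n x hx => ?_⟩
  -- Differentiate in one coordinate and freeze the others at `x₀`, which leaves the nonzero factor
  -- `ψ x₀ ^ (d - 1)` to divide by.
  have hlen : len (Pi.single i₀ n : Fin d → ℕ) = n := by simp [len]
  have hmem : Function.update (fun _ : Fin d => x₀) i₀ x ∈
      Set.Icc (fun _ : Fin d => -a) (fun _ => a) := by
    constructor <;> intro j <;> by_cases hj : j = i₀
    · subst hj; simpa using (abs_le.1 hx).1
    · simpa [hj] using (abs_le.1 ha).1
    · subst hj; simpa using (abs_le.1 hx).2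
    · simpa [hj] using (abs_le.1 ha).2
  have h1 := hbd _ hmem (Pi.single i₀ n)
  rw [multiDeriv_prod hψ, hlen] at h1
  have e : ∏ j, iteratedDeriv ((Pi.single i₀ n : Fin d → ℕ) j) ψ
      (Function.update (fun _ : Fin d => x₀) i₀ x j) = iteratedDeriv n ψ x * ψ x₀ ^ (d - 1) := by
    rw [← Finset.mul_prod_erase _ _ (Finset.mem_univ i₀), Finset.prod_congr rfl
      (g := fun _ => ψ x₀) fun j hj => by simp [Finset.ne_of_mem_erase hj]]
    simp
  simp only [e, norm_mul, norm_pow, Real.norm_eq_abs] at h1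
  rw [div_mul_eq_mul_div, div_mul_eq_mul_div, le_div_iff₀ hp]
  exact h1

/-- The derivative bounds of the infinite convolution with radii `ρ 3^{-e_p}`. -/
theorem exists_prod_le_exp_rpow {σ ρ L : ℝ} (hσ : 1 < σ) (hρ : 0 < ρ) (hL : 0 ≤ L) :
    ∃ B : ℝ, 0 ≤ B ∧ ∀ n : ℕ, ∏ k ∈ Finset.range n,
      L / (ρ * (1 / 3) ^ radiusExponent (σ - 1) (k + 1)) ≤ Real.exp (B * (n : ℝ) ^ σ) := by
  have hs : 0 < σ - 1 := by linarith
  refine ⟨(L / ρ + 4) * 2 ^ (σ - 1), by positivity, fun n => ?_⟩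
  rcases Nat.eq_zero_or_pos n with rfl | hn
  · simp [Real.zero_rpow (show σ ≠ 0 by linarith)]
  have hn1 : (1 : ℝ) ≤ n := by exact_mod_cast hn
  -- All factors get one common bound: `k + 2 ≤ n + 1 ≤ 2 * n` handles the index shift, and the
  -- `n`-fold product raises the exponent from `σ - 1` to `σ`.
  have h1 : ∀ k ∈ Finset.range n, L / (ρ * (1 / 3) ^ radiusExponent (σ - 1) (k + 1)) ≤
      Real.exp ((L / ρ + 4) * (2 * n) ^ (σ - 1)) := by
    intro k hk
    have hk : (k : ℝ) + 1 ≤ n := by exact_mod_cast Finset.mem_range.1 hk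
    have hexp : (3 : ℝ) ≤ Real.exp 2 := by linarith [Real.add_one_le_exp 2]
    have he : (radiusExponent (σ - 1) (k + 1) : ℝ) ≤ 2 * (2 * n) ^ (σ - 1) := by
      refine (radiusExponent_le hs _).trans ?_
      push_cast
      gcongr
      linarith
    have hone : (1 : ℝ) ≤ (2 * n) ^ (σ - 1) := Real.one_le_rpow (by linarith) hs.le
    have hq : 0 ≤ L / ρ := by positivity
    calc L / (ρ * (1 / 3) ^ radiusExponent (σ - 1) (k + 1))
        = L / ρ * 3 ^ radiusExponent (σ - 1) (k + 1) := by
          rw [one_div, inv_pow]; field_simp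
      _ ≤ Real.exp (L / ρ) * Real.exp 2 ^ radiusExponent (σ - 1) (k + 1) := by
          gcongr
          linarith [Real.add_one_le_exp (L / ρ)]
      _ = Real.exp (L / ρ + radiusExponent (σ - 1) (k + 1) * 2) := by
          rw [← Real.exp_nat_mul, ← Real.exp_add]
      _ ≤ _ := by
          apply Real.exp_le_exp.2
          nlinarith
  calc _ ≤ ∏ _k ∈ Finset.range n, Real.exp ((L / ρ + 4) * (2 * n) ^ (σ - 1)) :=
        Finset.prod_le_prod (fun k _ => by positivity) h1
    _ = Real.exp ((L / ρ + 4) * 2 ^ (σ - 1) * (n : ℝ) ^ σ) := by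
        rw [Finset.prod_const, Finset.card_range, ← Real.exp_nat_mul,
          Real.mul_rpow zero_le_two (by positivity)]
        congr 1
        have : (n : ℝ) ^ σ = n * (n : ℝ) ^ (σ - 1) := by
          rw [Real.rpow_sub_one (by positivity)]; field_simp
        rw [this]; ring

theorem tsupport_prod_subset {d : ℕ} {ψ : ℝ → ℝ} {a : ℝ} (h : ∀ x, ψ x ≠ 0 → |x| ≤ a) :
    tsupport (fun x : Fin d → ℝ => ∏ i, ψ (x i)) ⊆ Set.Icc (fun _ => -a) (fun _ => a) := by
  refine closure_minimal (fun x hx => ?_) isClosed_Icc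
  have hx : ∏ i, ψ (x i) ≠ 0 := hx
  have h1 : ∀ i, |x i| ≤ a := fun i => h _ (Finset.prod_ne_zero_iff.1 hx i (Finset.mem_univ i))
  exact ⟨fun i => (abs_le.1 (h1 i)).1, fun i => (abs_le.1 (h1 i)).2⟩

end ExtGevrey

/-! ### Assembly. -/

theorem proposition3p5 (d : ℕ) (hd : 1 ≤ d) (τ σ : ℝ) (hτ : 0 < τ) (hσ : 1 < σ)
    (a : ℝ) (ha : 0 < a) :
    ∃ φ : (Fin d → ℝ) → ℝ,
      ExtGevrey.IsBeurling τ σ φ ∧ ExtGevrey.IsRoumieu τ σ φ ∧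
      (∀ x, 0 ≤ φ x) ∧
      tsupport φ ⊆ Set.Icc (fun _ => -a) (fun _ => a) ∧
      (∫ x, φ x) = 1 ∧
      (∃ (f : ℝ → ℝ) (r : ℕ → ℝ) (ψ : ℝ → ℝ),
        ExtGevrey.IsBump f ∧ (∀ p, 0 < r p) ∧ Summable r ∧ ∑' p, r p ≤ a ∧
        ExtGevrey.IsInfiniteConv f r ψ ∧ ∀ x, φ x = ∏ i, ψ (x i)) ∧
      ∀ t : ℝ, 1 < t → ¬ ExtGevrey.IsGevrey t φ := by
  open ExtGevrey in
  obtain ⟨f, hf, ⟨B, hB, hlow⟩, hlow'⟩ := exists_isBump_fourier_lower_bound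
  have hs : 0 < σ - 1 := by linarith
  have hS := summable_radius hs
  set S := ∑' p, ((1 : ℝ) / 3) ^ radiusExponent (σ - 1) p with hSdef
  have hS0 : 0 < S := hS.tsum_pos (fun p => by positivity) 0 (by positivity)
  -- Normalises the total of the radii to exactly `a`.
  set ρ := a / S with hρdef
  have hρ : 0 < ρ := div_pos ha hS0
  let r : ℕ → ℝ := fun p => ρ * (1 / 3) ^ radiusExponent (σ - 1) p
  have hr : ∀ p, 0 < r p := fun p => by positivity
  have hrs : Summable r := hS.mul_left ρ
  have hra : ∑' p, r p ≤ a := by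
    simp only [r, tsum_mul_left]
    rw [← hSdef, hρdef, div_mul_cancel₀ _ hS0.ne']
  obtain ⟨ψ, hψ⟩ := exists_isInfiniteConv hf hr hrs
  have hsupp : ∀ x, ψ x ≠ 0 → |x| ≤ a := fun x => hψ.abs_le_of_ne_zero hf hr hrs hra
  have hint : ∫ x, ψ x = 1 := hψ.integral_eq_one hf hr hrs
  obtain ⟨G, hG⟩ := exists_abs_le_of_hasCompactSupport hf.smooth.continuous hf.hasCompactSupport
  have hG1 : ∀ x, |f x| ≤ G + 1 := fun x => (hG x).trans (by linarith)
  have hG0 : 0 ≤ G := (abs_nonneg _).trans (hG 0)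
  obtain ⟨b, hb, hprod⟩ := exists_prod_le_exp_rpow (L := ∫ y, |deriv f y|) hσ hρ
    (MeasureTheory.integral_nonneg fun y => abs_nonneg _)
  have hE : 0 < (G + 1) / r 0 := div_pos (by linarith) (hr 0)
  have hBeurling : IsBeurling τ σ fun x : Fin d → ℝ => ∏ i, ψ (x i) :=
    isBeurling_prod hτ hσ hψ.1 hE hb fun n x =>
      (hψ.abs_iteratedDeriv_le hf hr hG1 n x).trans
        (mul_le_mul_of_nonneg_left (hprod n) hE.le)
  refine ⟨fun x => ∏ i, ψ (x i), hBeurling, isRoumieu_of_isBeurling hBeurling,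
    fun x => Finset.prod_nonneg fun i _ => hψ.nonneg hf hr _, tsupport_prod_subset hsupp, ?_,
    ⟨f, r, ψ, hf, hr, hrs, hra, hψ, fun _ => rfl⟩, fun t ht hGev => ?_⟩
  · rw [MeasureTheory.integral_fintype_prod_volume_eq_prod (fun _ : Fin d => ψ)]
    simp [hint]
  obtain ⟨x₀, hx₀⟩ : ∃ x, ψ x ≠ 0 := by
    by_contra! hz
    simp [hz] at hint
  obtain ⟨h, hh, A, hA, hbd⟩ := hGev.exists_abs_iteratedDeriv_le hd hψ.1 hx₀ (hsupp _ hx₀)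
  -- Makes `(e_p + 1) ^ (-Q)` at most `(p + 1) ^ (-2)`, hence summable.
  obtain ⟨Q, hQ⟩ := exists_nat_ge (2 / (σ - 1))
  rw [div_le_iff₀ hs] at hQ
  obtain ⟨C, hC, hCm⟩ := exists_exp_neg_le_realFourier hB hlow hlow' Q
  have hsum := summable_inv_radiusExponent_pow hQ
  refine not_gevrey_of_fourier_lower_bound hψ.1 ha hsupp hρ (Q + 2)
    (C := C * ∑' p, 1 / ((radiusExponent (σ - 1) p : ℝ) + 1) ^ Q) (fun m => ?_)
    (by linarith : 0 ≤ t) hh hA hbd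
  -- At this frequency `ρ` cancels and every factor is evaluated at an integer power of `3`.
  have hm := hψ.exp_neg_tsum_le_realFourier hf hr hrs (ξ := 3 ^ m / ρ)
    (b := fun p => C * ((m : ℝ) + 1) ^ (Q + 2) * (1 / ((radiusExponent (σ - 1) p : ℝ) + 1) ^ Q))
    (fun p => by positivity) (hsum.mul_left _) fun p => by
      have e : r p * (3 ^ m / ρ) = 3 ^ m / 3 ^ radiusExponent (σ - 1) p := by
        simp only [r, one_div, inv_pow]
        field_simp
      rw [e]
      exact hCm m _
  rw [tsum_mul_left] at hm
  refine le_trans (le_of_eq ?_) hm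
  congr 2
  ring
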